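/- **Theorem 3 (Approximate Gibbs fixed point).** There is a universal constant $C>0$ such that the following holds. Let $H$ be a Hermitian matrix on a nonzero finite-dimensional Hilbert space, let $\beta>0$ and $\sigma_t>0$, and let $\rho_\beta=e^{-\beta H}/\mathrm{Tr}\,e^{-\beta H}$. Let $\{A^a\}_{a\in A}$ be a finite family of matrices (the jump operators) that is closed under adjoints, counted with multiplicity (there is a permutation $a\mapsto a'$ of $A$ with $A^{a'}=(A^{a})^\dagger$ for all $a$), and normalized by $\big\|\sum_{a}A^{a\dagger}A^a\big\|\le 1$ in operator norm. Let $f:\mathbb R\to\mathbb R$ be the Gaussian filter of width $\sigma_t$, $f(t)\propto e^{-t^2/(4\sigma_t^2)}$, normalized by $\int|f(t)|^2\,dt=1$. Let $\gamma:\mathbb R\to[0,1]$ be measurable and satisfy the KMS condition $\gamma(\omega)=e^{-\beta\omega}\gamma(-\omega)$ for all $\omega$. With $$\hat A^a(\omega)=\frac1{\sqrt{2\pi}}\int_{-\infty}^{\infty}e^{-i\omega t}f(t)\,e^{iHt}A^ae^{-iHt}\,dt,$$ consider the Lindbladian $$\mathcal L_\beta[\rho]=\sum_{a}\int_{-\infty}^{\infty}\gamma(\omega)\Big(\hat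 A^a(\omega)\rho\hat A^a(\omega)^\dagger-\tfrac12\big\{\hat A^a(\omega)^\dagger\hat A^a(\omega),\rho\big\}\Big)\,d\omega .$$ Let $t_{mix}(\mathcal L_\beta)\in[0,\infty]$ be the shortest time $t\ge 0$ for which $\|e^{\mathcal L_\beta t}[\rho-\rho']\|_1\le\frac12\|\rho-\rho'\|_1$ for all states $\rho,\rho'$ (and $\infty$ if there is no such time). Then $\mathcal L_\beta$ has a fixed point, i.e. a state $\rho_{fix}$ with $\mathcal L_\beta[\rho_{fix}]=0$, and every fixed point $\rho_{fix}$ satisfies $$\|\rho_{fix}-\rho_\beta\|_1\le C\,\frac{\beta}{\sigma_t}\sqrt{\log\!\big(2+\sigma_t/\beta\big)}\;t_{mix}(\mathcal L_\beta)\;=\;\tilde{\mathcal O}\Big(\frac{\beta}{\sigma_t}\,t_{mix}(\mathcal L_\beta)\Big)$$ in trace norm. -/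

import Mathlib

open scoped ComplexOrder ENNReal NNReal Matrix Matrix.Norms.L2Operator

namespace GibbsSampler

noncomputable section

/-- Superoperators: linear maps on `d × d` complex matrices. In finite dimension every linear map
is continuous; continuous maps are used because they carry a topology, hence integrals and
exponentials. -/
abbrev Superop (d : ℕ) : Type :=
  Matrix (Fin d) (Fin d) ℂ →L[ℂ] Matrix (Fin d) (Fin d) ℂ

/-- A quantum state (density matrix): positive semidefinite with unit trace. -/
def IsState {d : ℕ} (ρ : Matrix (Fin d) (Fin d) ℂ) : Prop :=
  ρ.PosSemidef ∧ ρ.trace = 1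

/-- The trace norm `‖X‖₁ = Tr √(Xᴴ X)`, the sum of the singular values of `X`. -/
def traceNorm {d : ℕ} (X : Matrix (Fin d) (Fin d) ℂ) : ℝ :=
  ∑ i, √((Matrix.isHermitian_conjTranspose_mul_self X).eigenvalues i)

/-- The Gibbs state `exp (-β H) / Tr exp (-β H)`. -/
def gibbs {d : ℕ} (H : Matrix (Fin d) (Fin d) ℂ) (β : ℝ) : Matrix (Fin d) (Fin d) ℂ :=
  (NormedSpace.exp ((-β : ℂ) • H)).trace⁻¹ • NormedSpace.exp ((-β : ℂ) • H)

/-- Heisenberg evolution `X(t) = exp (i H t) X exp (-i H t)`. -/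
def heisenberg {d : ℕ} (H X : Matrix (Fin d) (Fin d) ℂ) (t : ℝ) : Matrix (Fin d) (Fin d) ℂ :=
  NormedSpace.exp ((Complex.I * t) • H) * X * NormedSpace.exp ((-(Complex.I * t)) • H)

/-- The operator Fourier transform with filter `f`:
`X̂(ω) = (2π)^(-1/2) ∫ exp (-i ω t) f(t) X(t) dt`. -/
def operatorFT {d : ℕ} (H : Matrix (Fin d) (Fin d) ℂ) (f : ℝ → ℝ)
    (X : Matrix (Fin d) (Fin d) ℂ) (ω : ℝ) : Matrix (Fin d) (Fin d) ℂ :=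
  ((1 / √(2 * Real.pi) : ℝ) : ℂ) •
    ∫ t : ℝ, (Complex.exp (-(Complex.I * ω * t)) * (f t : ℂ)) • heisenberg H X t

/-- The dissipator of a Lindblad operator `K`: `ρ ↦ K ρ Kᴴ - (1/2) (Kᴴ K ρ + ρ Kᴴ K)`. -/
def dissipator {d : ℕ} (K : Matrix (Fin d) (Fin d) ℂ) : Superop d :=
  LinearMap.toContinuousLinearMap
    { toFun := fun ρ => K * ρ * Kᴴ - (1 / 2 : ℂ) • (Kᴴ * K * ρ + ρ * (Kᴴ * K))
      map_add' := fun x y => by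
        simp only [mul_add, add_mul, smul_add]
        abel
      map_smul' := fun c x => by
        simp only [Matrix.mul_smul, Matrix.smul_mul, RingHom.id_apply, smul_sub, smul_add,
          smul_comm c (1 / 2 : ℂ)] }

@[simp]
theorem dissipator_apply {d : ℕ} (K ρ : Matrix (Fin d) (Fin d) ℂ) :
    dissipator K ρ = K * ρ * Kᴴ - (1 / 2 : ℂ) • (Kᴴ * K * ρ + ρ * (Kᴴ * K)) := rfl

/-- The Lindbladian with Hamiltonian `H`, jump operators `A a`, filter `f` and transition weight
`γ`: `∑ a, ∫ γ(ω) 𝒟[Â a (ω)] dω`, with `𝒟` the dissipator. -/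
def lindbladian {d m : ℕ} (H : Matrix (Fin d) (Fin d) ℂ)
    (A : Fin m → Matrix (Fin d) (Fin d) ℂ) (f γ : ℝ → ℝ) : Superop d :=
  ∑ a, ∫ ω : ℝ, (γ ω : ℂ) • dissipator (operatorFT H f (A a) ω)

/-- At time `t` the semigroup `exp (t L)` has halved the trace distance of all pairs of states. -/
def HalvesDistanceAt {d : ℕ} (L : Superop d) (t : ℝ≥0) : Prop :=
  ∀ ρ ρ' : Matrix (Fin d) (Fin d) ℂ, IsState ρ → IsState ρ' →
    traceNorm (NormedSpace.exp (((t : ℝ) : ℂ) • L) (ρ - ρ')) ≤ 1 / 2 * traceNorm (ρ - ρ')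

/-- The mixing time of `L`: the shortest time at which the semigroup has halved all distances of
states, and `∞` if there is no such time. -/
def mixingTime {d : ℕ} (L : Superop d) : ℝ≥0∞ :=
  ⨅ (t : ℝ≥0) (_ : HalvesDistanceAt L t), (t : ℝ≥0∞)

/-- `ρ` is a fixed point of `L`: a state that is stationary under the evolution. -/
def IsFixedPoint {d : ℕ} (L : Superop d) (ρ : Matrix (Fin d) (Fin d) ℂ) : Prop :=
  IsState ρ ∧ L ρ = 0

end

end GibbsSampler

/-! The Gibbs state is almost stationary, and fast mixing turns that into closeness to every fixed
point. If `t` halves distances and `ρ` is fixed, then `ρ - ρβ = exp(tL)(ρ - ρβ) + (exp(tL)ρβ - ρβ)`.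
The first term costs half of the left side and the second at most `t‖L ρβ‖₁`, so `‖ρ - ρβ‖₁ ≤ 2t‖L
ρβ‖₁` (`traceNorm_fixedPoint_sub_le`). This needs trace-norm contractivity on Hermitian matrices,
which follows from positivity and trace preservation of the semigroup. Existence of a fixed point
comes from time averages and compactness.

It remains to show `‖L ρβ‖₁ = O(β/σ)`. In an energy eigenbasis the filtered jump `K(ω)` multiplies
the matrix entry of Bohr frequency `ν` by `g(ω - ν)`, with `g` a real even Gaussian of width of
order `1/σ`. Commuting `ρβ` past it produces `exp(-βν)`, while KMS supplies `exp(βω)`. Hence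
detailed balance fails only by the operator `B(ω)` with symbol `g(x)(exp(βx) - 1)`, `x = ω - ν`
(`approximate_detailed_balance`). Adjoint closure and `ω ↦ -ω` rewrite the jump term so that it
cancels the decay term up to `B` (`traceNorm_sum_integral_dissipator_le`).

The remainder is controlled by Cauchy–Schwarz and a Plancherel bound
(`sum_integral_trace_schurMul_sandwich_le`), which need only the L² norms of `g` and of
`g(x)(exp(βx) - 1)`. The latter is at most `β/σ` when `β ≤ σ`. No frequency cutoff is made, so the
logarithm enters only through a constant lower bound. -/

namespace GibbsSampler

/-! ### Trace norm: duality with contractions, Jordan decomposition. -/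

variable {d : ℕ}

/-- Spectral theorem with the diagonalizing unitary as a plain matrix. -/
theorem exists_spectral_decomposition {M : Matrix (Fin d) (Fin d) ℂ} (hM : M.IsHermitian) :
    ∃ V : Matrix (Fin d) (Fin d) ℂ, Vᴴ * V = 1 ∧ V * Vᴴ = 1 ∧
      M = V * Matrix.diagonal (fun i => (hM.eigenvalues i : ℂ)) * Vᴴ := by
  refine ⟨hM.eigenvectorUnitary, ?_, ?_, ?_⟩
  · exact Unitary.coe_star_mul_self hM.eigenvectorUnitary
  · exact Unitary.coe_mul_star_self hM.eigenvectorUnitary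
  · conv_lhs => rw [hM.spectral_theorem, Unitary.conjStarAlgAut_apply]
    rfl

theorem norm_unitary_conj {V : Matrix (Fin d) (Fin d) ℂ} (h₁ : Vᴴ * V = 1) (h₂ : V * Vᴴ = 1)
    (X : Matrix (Fin d) (Fin d) ℂ) : ‖V * X * Vᴴ‖ = ‖X‖ := by
  have hV : V ∈ unitary (Matrix (Fin d) (Fin d) ℂ) := Unitary.mem_iff.2 ⟨h₁, h₂⟩
  have h := CStarRing.norm_mul_mem_unitary (V * X) (Unitary.star_mem hV)
  rw [CStarRing.norm_mem_unitary_mul _ hV] at h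
  exact h

theorem trace_unitary_conj {V : Matrix (Fin d) (Fin d) ℂ} (h₁ : Vᴴ * V = 1)
    (X : Matrix (Fin d) (Fin d) ℂ) : (V * X * Vᴴ).trace = X.trace := by
  rw [Matrix.trace_mul_comm, ← mul_assoc, h₁, one_mul]

theorem posSemidef_unitary_diagonal (V : Matrix (Fin d) (Fin d) ℂ) {v : Fin d → ℝ}
    (hv : ∀ i, 0 ≤ v i) :
    (V * Matrix.diagonal (fun i => (v i : ℂ)) * Vᴴ).PosSemidef :=
  Matrix.PosSemidef.mul_mul_conjTranspose_same
    (Matrix.posSemidef_diagonal_iff.2 fun i => by exact_mod_cast hv i) V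

/-- Evaluate the trace in an eigenbasis `b` of `Xᴴ X`: there `‖X (b i)‖` is exactly the `i`-th
singular value. -/
theorem norm_trace_mul_le (W X : Matrix (Fin d) (Fin d) ℂ) :
    ‖(W * X).trace‖ ≤ ‖W‖ * traceNorm X := by
  have hX := Matrix.isHermitian_conjTranspose_mul_self X
  set b := hX.eigenvectorBasis
  have h1 : (W * X).trace =
      ∑ i, inner ℂ (b i) (Matrix.toEuclideanLin (W * X) (b i)) := by
    rw [← LinearMap.trace_eq_sum_inner, Matrix.toEuclideanLin_eq_toLin_orthonormal,
      Matrix.trace_toLin_eq]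
  have h2 : ∀ i, ‖Matrix.toEuclideanLin X (b i)‖ = √(hX.eigenvalues i) := by
    intro i
    rw [eq_comm, Real.sqrt_eq_iff_mul_self_eq (Matrix.eigenvalues_conjTranspose_mul_self_nonneg X i)
      (norm_nonneg _), hX.eigenvalues_eq, ← sq, ← inner_self_eq_norm_sq (𝕜 := ℂ)]
    rw [EuclideanSpace.inner_eq_star_dotProduct, ← Matrix.mulVec_mulVec, Matrix.dotProduct_mulVec,
      Matrix.vecMul_conjTranspose, star_star, Matrix.toLpLin_apply, dotProduct_comm]
  rw [h1, traceNorm, Finset.mul_sum]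
  refine (norm_sum_le _ _).trans (Finset.sum_le_sum fun i _ => ?_)
  rw [← h2]
  refine (norm_inner_le_norm _ _).trans ?_
  rw [b.orthonormal.norm_eq_one, one_mul]
  have := Matrix.l2_opNorm_mulVec W (Matrix.toEuclideanLin X (b i))
  simpa [Matrix.toLpLin_apply, Matrix.mulVec_mulVec] using this

/-- The dual witness is the adjoint of the polar partial isometry, `W = |X|⁻¹ Xᴴ` with a
pseudo-inverse, so that `W X = |X|`. -/
theorem exists_trace_mul_eq_traceNorm (X : Matrix (Fin d) (Fin d) ℂ) :
    ∃ W : Matrix (Fin d) (Fin d) ℂ, ‖W‖ ≤ 1 ∧ (W * X).trace = traceNorm X := by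
  have hX := Matrix.isHermitian_conjTranspose_mul_self X
  obtain ⟨V, h₁, h₂, h₃⟩ := exists_spectral_decomposition hX
  have hn := Matrix.eigenvalues_conjTranspose_mul_self_nonneg X
  set l := hX.eigenvalues
  -- The convention `0⁻¹ = 0` makes this the pseudo-inverse of `|X|` on the kernel of `X`.
  let D : Matrix (Fin d) (Fin d) ℂ := Matrix.diagonal fun i => (((√(l i))⁻¹ : ℝ) : ℂ)
  have hD : Dᴴ = D := by
    simp only [D, Matrix.diagonal_conjTranspose]
    congr 1; ext i; simp
  have key : ∀ Y Z : Matrix (Fin d) (Fin d) ℂ, V * Y * Vᴴ * (V * Z * Vᴴ) = V * (Y * Z) * Vᴴ := by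
    intro Y Z
    calc _ = V * Y * (Vᴴ * V) * Z * Vᴴ := by simp only [mul_assoc]
      _ = _ := by rw [h₁]; simp only [mul_assoc, mul_one]
  refine ⟨V * D * Vᴴ * Xᴴ, ?_, ?_⟩
  · have h4 : V * D * Vᴴ * Xᴴ * (V * D * Vᴴ * Xᴴ)ᴴ
        = V * Matrix.diagonal (fun i => (((√(l i))⁻¹ * l i * (√(l i))⁻¹ : ℝ) : ℂ)) * Vᴴ := by
      calc _ = V * D * Vᴴ * (Xᴴ * X) * (V * D * Vᴴ) := by
            simp only [Matrix.conjTranspose_mul, Matrix.conjTranspose_conjTranspose, hD, mul_assoc]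
        _ = _ := by
          rw [h₃, key, key]
          simp [D, Matrix.diagonal_mul_diagonal]
    have h5 : ‖V * D * Vᴴ * Xᴴ‖ * ‖V * D * Vᴴ * Xᴴ‖ ≤ 1 := by
      rw [← CStarRing.norm_self_mul_star, Matrix.star_eq_conjTranspose, h4, norm_unitary_conj h₁ h₂,
        Matrix.l2_opNorm_diagonal]
      refine (pi_norm_le_iff_of_nonneg zero_le_one).2 fun i => ?_
      rw [Complex.norm_real, Real.norm_eq_abs, abs_of_nonneg (by have := hn i; positivity)]
      rcases (hn i).eq_or_lt with h | h
      · simp [l, ← h]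
      · have h6 : 0 < √(l i) := Real.sqrt_pos.2 h
        have h7 : √(l i) * √(l i) = l i := Real.mul_self_sqrt h.le
        apply le_of_eq
        field_simp
        rw [sq, h7]
    nlinarith [norm_nonneg (V * D * Vᴴ * Xᴴ)]
  · rw [mul_assoc, h₃, key, trace_unitary_conj h₁, Matrix.diagonal_mul_diagonal,
      Matrix.trace_diagonal, traceNorm, Complex.ofReal_sum]
    refine Finset.sum_congr rfl fun i _ => ?_
    rw [← Complex.ofReal_mul]
    congr 1
    rcases (hn i).eq_or_lt with h | h
    · simp [l, ← h]
    · have h7 : √(l i) * √(l i) = l i := Real.mul_self_sqrt h.le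
      have h6 : 0 < √(l i) := Real.sqrt_pos.2 h
      change (√(l i))⁻¹ * l i = √(l i)
      field_simp
      rw [sq, h7]

theorem traceNorm_nonneg (X : Matrix (Fin d) (Fin d) ℂ) : 0 ≤ traceNorm X :=
  Finset.sum_nonneg fun _ _ => Real.sqrt_nonneg _

/-- A bound for all contractions bounds the trace norm. -/
theorem traceNorm_le_of_forall {X : Matrix (Fin d) (Fin d) ℂ} {b : ℝ}
    (h : ∀ W : Matrix (Fin d) (Fin d) ℂ, ‖W‖ ≤ 1 → ‖(W * X).trace‖ ≤ b) : traceNorm X ≤ b := by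
  obtain ⟨W, hW, hWX⟩ := exists_trace_mul_eq_traceNorm X
  have := h W hW
  rwa [hWX, Complex.norm_real, Real.norm_eq_abs, abs_of_nonneg (traceNorm_nonneg X)] at this

theorem norm_trace_mul_le_traceNorm {W : Matrix (Fin d) (Fin d) ℂ} (hW : ‖W‖ ≤ 1)
    (X : Matrix (Fin d) (Fin d) ℂ) : ‖(W * X).trace‖ ≤ traceNorm X :=
  (norm_trace_mul_le W X).trans (mul_le_of_le_one_left (traceNorm_nonneg X) hW)

theorem traceNorm_add_le (X Y : Matrix (Fin d) (Fin d) ℂ) :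
    traceNorm (X + Y) ≤ traceNorm X + traceNorm Y := by
  refine traceNorm_le_of_forall fun W hW => ?_
  rw [mul_add, Matrix.trace_add]
  exact (norm_add_le _ _).trans (add_le_add (norm_trace_mul_le_traceNorm hW X)
    (norm_trace_mul_le_traceNorm hW Y))

theorem traceNorm_sub_le (X Y : Matrix (Fin d) (Fin d) ℂ) :
    traceNorm (X - Y) ≤ traceNorm X + traceNorm Y := by
  refine traceNorm_le_of_forall fun W hW => ?_
  rw [mul_sub, Matrix.trace_sub]
  exact (norm_sub_le _ _).trans (add_le_add (norm_trace_mul_le_traceNorm hW X)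
    (norm_trace_mul_le_traceNorm hW Y))

theorem trace_mul_conjTranspose_self_re (M : Matrix (Fin d) (Fin d) ℂ) :
    (M * Mᴴ).trace.re = ∑ i, ∑ j, ‖M i j‖ ^ 2 := by
  simp only [Matrix.trace, Matrix.diag_apply, Matrix.mul_apply, Matrix.conjTranspose_apply,
    Complex.re_sum]
  refine Finset.sum_congr rfl fun i _ => Finset.sum_congr rfl fun j _ => ?_
  rw [Complex.star_def, Complex.mul_conj, Complex.ofReal_re, Complex.normSq_eq_norm_sq]

/-- Hölder's inequality for a positive semidefinite matrix. -/
theorem norm_trace_mul_le_of_posSemidef (W : Matrix (Fin d) (Fin d) ℂ)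
    {Y : Matrix (Fin d) (Fin d) ℂ} (hY : Y.PosSemidef) :
    ‖(W * Y).trace‖ ≤ ‖W‖ * Y.trace.re := by
  obtain ⟨V, h₁, h₂, h₃⟩ := exists_spectral_decomposition hY.1
  have hn := hY.eigenvalues_nonneg
  have h4 : (W * Y).trace = ∑ i, (Vᴴ * W * V) i i * (hY.1.eigenvalues i : ℂ) := by
    conv_lhs => rw [h₃]
    rw [← mul_assoc, Matrix.trace_mul_comm, ← mul_assoc, ← mul_assoc, Matrix.trace]
    simp [Matrix.mul_diagonal]
  have h5 : Y.trace.re = ∑ i, hY.1.eigenvalues i := by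
    rw [hY.1.trace_eq_sum_eigenvalues]; simp
  have h6 : ‖Vᴴ * W * V‖ = ‖W‖ := by
    have := norm_unitary_conj (V := Vᴴ) (by simpa using h₂) (by simpa using h₁) W
    simpa using this
  rw [h4, h5, Finset.mul_sum]
  refine (norm_sum_le _ _).trans (Finset.sum_le_sum fun i _ => ?_)
  rw [norm_mul, Complex.norm_real, Real.norm_eq_abs, abs_of_nonneg (hn i)]
  refine mul_le_mul_of_nonneg_right ?_ (hn i)
  rw [← h6]
  have := Matrix.l2_opNorm_mulVec (Vᴴ * W * V) (EuclideanSpace.single i 1)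
  rw [PiLp.norm_single, norm_one, mul_one] at this
  refine le_trans ?_ this
  refine le_trans ?_ (PiLp.norm_apply_le _ i)
  simp

/-- Jordan decomposition of a Hermitian matrix, with additivity of the trace norm. -/
theorem exists_jordan_decomposition {X : Matrix (Fin d) (Fin d) ℂ} (hX : X.IsHermitian) :
    ∃ P N : Matrix (Fin d) (Fin d) ℂ, P.PosSemidef ∧ N.PosSemidef ∧ X = P - N ∧
      P.trace.re + N.trace.re ≤ traceNorm X := by
  obtain ⟨V, h₁, h₂, h₃⟩ := exists_spectral_decomposition hX
  set l := hX.eigenvalues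
  refine ⟨V * Matrix.diagonal (fun i => ((max (l i) 0 : ℝ) : ℂ)) * Vᴴ,
    V * Matrix.diagonal (fun i => ((max (-l i) 0 : ℝ) : ℂ)) * Vᴴ,
    posSemidef_unitary_diagonal V fun i => le_max_right _ _,
    posSemidef_unitary_diagonal V fun i => le_max_right _ _, ?_, ?_⟩
  · rw [← sub_mul, ← mul_sub, Matrix.diagonal_sub]
    conv_lhs => rw [h₃]
    congr 3; ext i
    rw [← Complex.ofReal_sub]
    congr 1

    rcases le_total (l i) 0 with h | h
    · rw [max_eq_right h, max_eq_left (by linarith)]; ring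
    · rw [max_eq_left h, max_eq_right (by linarith)]; ring
  · rw [trace_unitary_conj h₁, trace_unitary_conj h₁]
    -- Testing `X` against the contraction `sign X` gives `Tr |X|`, which is the sum of the two
    -- traces.
    have hS : ‖V * Matrix.diagonal (fun i => (((SignType.sign (l i) : SignType) : ℝ) : ℂ)) * Vᴴ‖
        ≤ 1 := by
      rw [norm_unitary_conj h₁ h₂, Matrix.l2_opNorm_diagonal]
      refine (pi_norm_le_iff_of_nonneg zero_le_one).2 fun i => ?_
      rw [Complex.norm_real]
      rcases lt_trichotomy (l i) 0 with h | h | h <;> simp [h]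
    have h4 := norm_trace_mul_le_traceNorm hS X
    have h5 : (V * Matrix.diagonal (fun i => (((SignType.sign (l i) : SignType) : ℝ) : ℂ)) * Vᴴ * X)
        = V * Matrix.diagonal (fun i => ((|l i| : ℝ) : ℂ)) * Vᴴ := by
      conv_lhs => rw [h₃]
      calc _ = V * Matrix.diagonal (fun i => (((SignType.sign (l i) : SignType) : ℝ) : ℂ))
            * (Vᴴ * V) * Matrix.diagonal (fun i => (l i : ℂ)) * Vᴴ := by simp only [mul_assoc]
        _ = _ := by
          rw [h₁, mul_one, mul_assoc V, Matrix.diagonal_mul_diagonal]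
          congr 3; ext i
          rw [← Complex.ofReal_mul, sign_mul_self]
    rw [h5, trace_unitary_conj h₁] at h4
    refine le_trans (le_of_eq ?_) ((Complex.re_le_norm _).trans h4)
    simp only [Matrix.trace_diagonal, Complex.re_sum, Complex.ofReal_re,
      ← Finset.sum_add_distrib]
    refine Finset.sum_congr rfl fun i _ => ?_
    rcases le_total (l i) 0 with h | h
    · rw [max_eq_right h, max_eq_left (by linarith), abs_of_nonpos h]; ring
    · rw [max_eq_left h, max_eq_right (by linarith), abs_of_nonneg h]; ring

theorem traceNorm_le_trace_of_posSemidef {Y : Matrix (Fin d) (Fin d) ℂ} (hY : Y.PosSemidef) :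
    traceNorm Y ≤ Y.trace.re :=
  traceNorm_le_of_forall fun W hW => (norm_trace_mul_le_of_posSemidef W hY).trans
    (mul_le_of_le_one_left (Complex.nonneg_iff.1 hY.trace_nonneg).1 hW)

end GibbsSampler

/-! ### Invariant closed sets of a semigroup via Euler steps. -/

namespace GibbsSampler

open Filter Topology

/-- Telescoping, with one spare power of `M`. Only `‖1‖ ≤ 1` is asked, so that operators on the zero
space are allowed. -/
theorem norm_pow_sub_pow_le {R : Type*} [SeminormedRing R] {a b : R} {M : ℝ} (h1 : ‖(1 : R)‖ ≤ 1)
    (hM : 1 ≤ M) (ha : ‖a‖ ≤ M) (hb : ‖b‖ ≤ M) (n : ℕ) :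
    ‖a ^ n - b ^ n‖ ≤ n * M ^ n * ‖a - b‖ := by
  have hpow : ∀ n, ‖b ^ n‖ ≤ M ^ n := by
    intro n
    induction n with
    | zero => simpa using h1
    | succ k ih =>
      rw [pow_succ, pow_succ]
      exact (norm_mul_le _ _).trans (mul_le_mul ih hb (norm_nonneg _) (by positivity))
  induction n with
  | zero => simp
  | succ k ih =>
    have h : a ^ (k + 1) - b ^ (k + 1) = a * (a ^ k - b ^ k) + (a - b) * b ^ k := by
      rw [pow_succ', pow_succ']; noncomm_ring
    rw [h]
    have hk : M ^ k ≤ M ^ (k + 1) := pow_le_pow_right₀ hM (Nat.le_succ k)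
    calc _ ≤ ‖a‖ * ‖a ^ k - b ^ k‖ + ‖a - b‖ * ‖b ^ k‖ :=
          (norm_add_le _ _).trans (add_le_add (norm_mul_le _ _) (norm_mul_le _ _))
      _ ≤ M * (k * M ^ k * ‖a - b‖) + ‖a - b‖ * M ^ (k + 1) := by
          gcongr
          exact (hpow k).trans hk
      _ = _ := by push_cast; ring

/-- A closed set invariant under the second order perturbed Euler steps `1 + h L + h² Q` of a
bounded operator `L` is invariant under the semigroup generated by `L`. -/
theorem exp_smul_mem_of_euler_step {E : Type*} [NormedAddCommGroup E] [NormedSpace ℂ E]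
    [CompleteSpace E] {K : Set E} (hK : IsClosed K) (L Q : E →L[ℂ] E)
    (hstep : ∀ h : ℝ, 0 ≤ h → ∀ x ∈ K, x + (h : ℂ) • L x + (h : ℂ) ^ 2 • Q x ∈ K)
    {t : ℝ} (ht : 0 ≤ t) {x : E} (hx : x ∈ K) :
    NormedSpace.exp ((t : ℂ) • L) x ∈ K := by
  let P : ℂ → (E →L[ℂ] E) := fun h => 1 + h • L + h ^ 2 • Q
  -- The local error is `o(h)`, so `n + 1` steps of length `t / (n + 1)` accumulate an error tending
  -- to zero.
  let D : ℂ → (E →L[ℂ] E) := fun h => NormedSpace.exp (h • L) - P h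
  have hD0 : D 0 = 0 := by simp [D, P]
  have hD : HasDerivAt D 0 0 := by
    have h1 := hasDerivAt_exp_smul_const (𝕂 := ℂ) L 0
    have h2 : HasDerivAt P L 0 := by
      have h3 := ((hasDerivAt_id (0 : ℂ)).smul_const L).const_add (1 : E →L[ℂ] E)
      have h4 := ((hasDerivAt_id (0 : ℂ)).pow 2).smul_const Q
      have h5 := h3.add h4
      simp only [id_eq, one_smul, Nat.cast_ofNat] at h5
      refine h5.congr_deriv ?_
      simp
    refine (h1.sub h2).congr_deriv ?_
    simp
  rcases ht.eq_or_lt with rfl | ht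
  · simpa using hx
  let s : ℕ → ℂ := fun n => ((t / (n + 1 : ℕ) : ℝ) : ℂ)
  have hs0 : Tendsto s atTop (𝓝 0) := by
    have : Tendsto (fun n : ℕ => t / ((n + 1 : ℕ) : ℝ)) atTop (𝓝 0) :=
      (tendsto_const_div_atTop_nhds_zero_nat t).comp (tendsto_add_atTop_nat 1)
    exact Complex.ofReal_zero ▸ (Complex.continuous_ofReal.tendsto 0).comp this
  have hsne : ∀ n, s n ≠ 0 := fun n => by
    simp only [s, ne_eq, Complex.ofReal_eq_zero]; positivity
  have hslope : Tendsto (fun n => (n + 1 : ℕ) * ‖D (s n)‖) atTop (𝓝 0) := by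
    have h1 := hasDerivAt_iff_tendsto_slope_zero.1 hD
    have h2 : Tendsto s atTop (𝓝[≠] 0) :=
      tendsto_nhdsWithin_iff.2 ⟨hs0, Eventually.of_forall hsne⟩
    have h3 := ((h1.comp h2).norm).const_mul t
    simp only [Function.comp_def, zero_add, hD0, sub_zero, norm_zero, mul_zero] at h3
    refine h3.congr fun n => ?_
    rw [norm_smul, norm_inv, Complex.norm_real, Real.norm_eq_abs, abs_of_pos (by positivity),
      ← mul_assoc]
    congr 1
    have : ((n + 1 : ℕ) : ℝ) ≠ 0 := by positivity
    field_simp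
  -- The extra `1` pays for the local error, eventually below `1 / (n + 1)`; one growth constant
  -- then serves both the Euler step and the exact step.
  set c : ℝ := t * ‖L‖ + t ^ 2 * ‖Q‖ + 1 with hc
  have hc0 : 0 ≤ c := by positivity
  have hone : ‖(1 : E →L[ℂ] E)‖ ≤ 1 := ContinuousLinearMap.norm_id_le
  have hP : ∀ n, ‖P (s n)‖ ≤ 1 + (t * ‖L‖ + t ^ 2 * ‖Q‖) / (n + 1 : ℕ) := by
    intro n
    have hsn : ‖s n‖ = t / (n + 1 : ℕ) := by
      rw [Complex.norm_real, Real.norm_eq_abs, abs_of_pos (by positivity)]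
    have hn : (1 : ℝ) ≤ (n + 1 : ℕ) := by exact_mod_cast Nat.succ_le_succ (Nat.zero_le n)
    calc ‖P (s n)‖ ≤ ‖(1 : E →L[ℂ] E)‖ + ‖s n • L‖ + ‖s n ^ 2 • Q‖ := norm_add₃_le
      _ ≤ 1 + t / (n + 1 : ℕ) * ‖L‖ + (t / (n + 1 : ℕ)) ^ 2 * ‖Q‖ := by
          rw [norm_smul, norm_smul, norm_pow, hsn]; gcongr
      _ ≤ 1 + t / (n + 1 : ℕ) * ‖L‖ + t ^ 2 / (n + 1 : ℕ) * ‖Q‖ := by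
          gcongr
          rw [div_pow]
          exact div_le_div_of_nonneg_left (by positivity) (by positivity) (by nlinarith)
      _ = _ := by ring
  have hpowP : ∀ n : ℕ, (P (s n) ^ (n + 1)) x ∈ K := by
    intro n
    have : ∀ k : ℕ, (P (s n) ^ k) x ∈ K := by
      intro k
      induction k with
      | zero => simpa using hx
      | succ k ih =>
        rw [pow_succ']
        exact hstep _ (by positivity) _ ih
    exact this _
  have hexp : ∀ n : ℕ, NormedSpace.exp (s n • L) ^ (n + 1) = NormedSpace.exp ((t : ℂ) • L) := by
    intro n
    let _ : NormedAlgebra ℚ (E →L[ℂ] E) := NormedAlgebra.restrictScalars ℚ ℂ _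
    rw [← NormedSpace.exp_nsmul, ← Nat.cast_smul_eq_nsmul ℂ, smul_smul]
    congr 2
    have : ((n : ℂ) + 1) ≠ 0 := by exact_mod_cast Nat.succ_ne_zero n
    simp only [s]; push_cast; field_simp
  have hlim : Tendsto (fun n : ℕ => P (s n) ^ (n + 1)) atTop (𝓝 (NormedSpace.exp ((t : ℂ) • L))) := by
    rw [tendsto_iff_norm_sub_tendsto_zero]
    have hub : Tendsto (fun n => Real.exp c * ((n + 1 : ℕ) * ‖D (s n)‖)) atTop (𝓝 0) := by
      simpa using hslope.const_mul (Real.exp c)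
    refine squeeze_zero' (Eventually.of_forall fun _ => norm_nonneg _) ?_ hub
    filter_upwards [hslope.eventually (gt_mem_nhds zero_lt_one)] with n hn
    have hn0 : (0 : ℝ) < (n + 1 : ℕ) := by positivity
    have hDn : ‖D (s n)‖ ≤ 1 / (n + 1 : ℕ) := by
      rw [le_div_iff₀ hn0]; linarith
    have hle : 1 + (t * ‖L‖ + t ^ 2 * ‖Q‖) / (n + 1 : ℕ) ≤ 1 + c / (n + 1 : ℕ) := by
      gcongr; rw [hc]; linarith
    have hA : ‖NormedSpace.exp (s n • L)‖ ≤ 1 + c / (n + 1 : ℕ) := by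
      have : NormedSpace.exp (s n • L) = P (s n) + D (s n) := by simp [D]
      rw [this]
      refine (norm_add_le _ _).trans ((add_le_add (hP n) hDn).trans (le_of_eq ?_))
      rw [hc]; ring
    have h1 := norm_pow_sub_pow_le hone (by simp only [le_add_iff_nonneg_right]; positivity)
      ((hP n).trans hle) hA (n + 1)
    rw [hexp] at h1
    have h2 : (1 + c / (n + 1 : ℕ)) ^ (n + 1) ≤ Real.exp c := by
      calc _ ≤ (Real.exp (c / (n + 1 : ℕ))) ^ (n + 1) := by
            gcongr
            rw [add_comm]; exact Real.add_one_le_exp _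
        _ = _ := by rw [← Real.exp_nat_mul]; congr 1; field_simp
    have h3 : ‖P (s n) - NormedSpace.exp (s n • L)‖ = ‖D (s n)‖ := norm_sub_rev _ _
    rw [h3] at h1
    calc _ ≤ _ := h1
      _ = (1 + c / (n + 1 : ℕ)) ^ (n + 1) * ((n + 1 : ℕ) * ‖D (s n)‖) := by ring
      _ ≤ _ := by gcongr
  have hlimx : Tendsto (fun n : ℕ => (P (s n) ^ (n + 1)) x) atTop
      (𝓝 (NormedSpace.exp ((t : ℂ) • L) x)) :=
    ((ContinuousLinearMap.apply ℂ E x).continuous.tendsto _).comp hlim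
  exact hK.mem_of_tendsto hlimx (Eventually.of_forall hpowP)

end GibbsSampler

/-! ### Semigroups of Markov generators: positivity, contraction, fixed points. -/

namespace GibbsSampler

open Filter Topology

section Banach

variable {E : Type*} [NormedAddCommGroup E] [NormedSpace ℂ E]

theorem exp_ofReal_zero_smul_apply (L : E →L[ℂ] E) (x : E) :
    NormedSpace.exp (((0 : ℝ) : ℂ) • L) x = x := by
  rw [Complex.ofReal_zero, zero_smul, NormedSpace.exp_zero]
  rfl

variable [CompleteSpace E]

theorem hasDerivAt_exp_ofReal_smul_apply (L : E →L[ℂ] E) (x : E) (s : ℝ) :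
    HasDerivAt (fun s : ℝ => NormedSpace.exp ((s : ℂ) • L) x)
      (NormedSpace.exp ((s : ℂ) • L) (L x)) s := by
  have h1 := (hasDerivAt_exp_smul_const (𝕂 := ℂ) L (s : ℂ))
  have h2 := HasDerivAt.scomp (𝕜' := ℂ) s h1 Complex.ofRealCLM.hasDerivAt
  simp only [Complex.ofRealCLM_apply, Complex.ofReal_one, one_smul] at h2
  exact ((ContinuousLinearMap.apply ℂ _ x).restrictScalars ℝ).hasFDerivAt.comp_hasDerivAt s h2

theorem hasDerivAt_exp_ofReal_smul_apply' (L : E →L[ℂ] E) (x : E) (s : ℝ) :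
    HasDerivAt (fun s : ℝ => NormedSpace.exp ((s : ℂ) • L) x)
      (L (NormedSpace.exp ((s : ℂ) • L) x)) s := by
  have h1 := (hasDerivAt_exp_smul_const' (𝕂 := ℂ) L (s : ℂ))
  have h2 := HasDerivAt.scomp (𝕜' := ℂ) s h1 Complex.ofRealCLM.hasDerivAt
  simp only [Complex.ofRealCLM_apply, Complex.ofReal_one, one_smul] at h2
  exact ((ContinuousLinearMap.apply ℂ _ x).restrictScalars ℝ).hasFDerivAt.comp_hasDerivAt s h2

end Banach

variable {d : ℕ}

/-- A superoperator of the form `ρ ↦ Φ ρ + G ρ + ρ Gᴴ` with `Φ` positive, which annihilates the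
trace. -/
def IsMarkovGenerator (L : Superop d) : Prop :=
  (∃ G : Matrix (Fin d) (Fin d) ℂ, ∀ ρ : Matrix (Fin d) (Fin d) ℂ, ρ.PosSemidef →
    (L ρ - (G * ρ + ρ * Gᴴ)).PosSemidef) ∧ ∀ ρ, (L ρ).trace = 0

theorem isClosed_posSemidef : IsClosed {M : Matrix (Fin d) (Fin d) ℂ | M.PosSemidef} := by
  open scoped MatrixOrder in
  simpa only [Matrix.nonneg_iff_posSemidef] using
    (CStarAlgebra.isClosed_nonneg (A := Matrix (Fin d) (Fin d) ℂ))

theorem posSemidef_integral {α : Type*} [MeasurableSpace α] {μ : MeasureTheory.Measure α}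
    {F : α → Matrix (Fin d) (Fin d) ℂ} (hF : ∀ᵐ x ∂μ, (F x).PosSemidef) :
    (∫ x, F x ∂μ).PosSemidef := by
  open scoped MatrixOrder in
  have h : 0 ≤ ∫ x, F x ∂μ := MeasureTheory.integral_nonneg_of_ae <| by
    filter_upwards [hF] with x hx using Matrix.nonneg_iff_posSemidef.2 hx
  exact Matrix.nonneg_iff_posSemidef.1 h

/-- The trace as a continuous linear functional. -/
noncomputable def traceCLM (d : ℕ) : Matrix (Fin d) (Fin d) ℂ →L[ℂ] ℂ :=
  LinearMap.toContinuousLinearMap (Matrix.traceLinearMap (Fin d) ℂ ℂ)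

@[simp]
theorem traceCLM_apply (X : Matrix (Fin d) (Fin d) ℂ) : traceCLM d X = X.trace := rfl

/-- The functional `X ↦ Tr (W X)`. -/
noncomputable def traceMulCLM (W : Matrix (Fin d) (Fin d) ℂ) : Matrix (Fin d) (Fin d) ℂ →L[ℂ] ℂ :=
  LinearMap.toContinuousLinearMap (Matrix.traceLinearMap (Fin d) ℂ ℂ ∘ₗ LinearMap.mulLeft ℂ W)

@[simp]
theorem traceMulCLM_apply (W X : Matrix (Fin d) (Fin d) ℂ) :
    traceMulCLM W X = (W * X).trace := rfl

theorem exp_zero_smul_apply (L : Superop d) (ρ : Matrix (Fin d) (Fin d) ℂ) :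
    NormedSpace.exp (((0 : ℝ) : ℂ) • L) ρ = ρ :=
  exp_ofReal_zero_smul_apply L ρ

theorem hasDerivAt_exp_smul (L : Superop d) (ρ : Matrix (Fin d) (Fin d) ℂ) (s : ℝ) :
    HasDerivAt (fun s : ℝ => NormedSpace.exp ((s : ℂ) • L) ρ)
      (NormedSpace.exp ((s : ℂ) • L) (L ρ)) s :=
  hasDerivAt_exp_ofReal_smul_apply L ρ s

theorem hasDerivAt_exp_smul' (L : Superop d) (ρ : Matrix (Fin d) (Fin d) ℂ) (s : ℝ) :
    HasDerivAt (fun s : ℝ => NormedSpace.exp ((s : ℂ) • L) ρ)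
      (L (NormedSpace.exp ((s : ℂ) • L) ρ)) s :=
  hasDerivAt_exp_ofReal_smul_apply' L ρ s

theorem exp_smul_apply_eq_self {L : Superop d} {ρ : Matrix (Fin d) (Fin d) ℂ} (h : L ρ = 0)
    (t : ℝ) : NormedSpace.exp ((t : ℂ) • L) ρ = ρ := by
  have hd : ∀ s : ℝ, HasDerivAt (fun s : ℝ => NormedSpace.exp ((s : ℂ) • L) ρ) 0 s := fun s => by
    simpa [h] using hasDerivAt_exp_smul L ρ s
  have := is_const_of_deriv_eq_zero (fun s => (hd s).differentiableAt) (fun s => (hd s).deriv) t 0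
  simpa only [exp_zero_smul_apply, traceCLM_apply] using this

namespace IsMarkovGenerator

variable {L : Superop d} (hL : IsMarkovGenerator L)
include hL

/-- The generator is controlled only on positive matrices; the Jordan decomposition extends this to
Hermitian ones. -/
theorem isHermitian_apply {X : Matrix (Fin d) (Fin d) ℂ} (hX : X.IsHermitian) :
    (L X).IsHermitian := by
  obtain ⟨P, N, hP, hN, rfl, -⟩ := exists_jordan_decomposition hX
  obtain ⟨⟨G, hG⟩, -⟩ := hL
  have h : ∀ Y : Matrix (Fin d) (Fin d) ℂ, Y.PosSemidef → (L Y).IsHermitian := by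
    intro Y hY
    have h2 : (G * Y + Y * Gᴴ).IsHermitian := by
      rw [Matrix.IsHermitian, Matrix.conjTranspose_add, Matrix.conjTranspose_mul,
        Matrix.conjTranspose_mul, hY.1, Matrix.conjTranspose_conjTranspose, add_comm]
    simpa using (hG Y hY).1.add h2
  rw [map_sub]
  exact (h P hP).sub (h N hN)

/-- With `Φ ρ = L ρ - (G ρ + ρ Gᴴ)`, the step `(1 + hG) ρ (1 + hG)ᴴ + h Φ ρ` is manifestly positive
and equals `ρ + h L ρ + h² G ρ Gᴴ`. This is a perturbed Euler step with `Q ρ = G ρ Gᴴ`. -/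
theorem posSemidef_exp {t : ℝ} (ht : 0 ≤ t) {ρ : Matrix (Fin d) (Fin d) ℂ} (hρ : ρ.PosSemidef) :
    (NormedSpace.exp ((t : ℂ) • L) ρ).PosSemidef := by
  obtain ⟨⟨G, hG⟩, -⟩ := hL
  refine exp_smul_mem_of_euler_step isClosed_posSemidef L (LinearMap.toContinuousLinearMap
    (LinearMap.mulLeft ℂ G ∘ₗ LinearMap.mulRight ℂ Gᴴ)) (fun h hh x hx => ?_) ht hρ
  have h1 := Matrix.PosSemidef.mul_mul_conjTranspose_same hx (1 + (h : ℂ) • G)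
  have h2 := (hG x hx).smul (show (0 : ℂ) ≤ h by exact_mod_cast hh)
  have h3 := h1.add h2
  convert h3 using 1
  simp only [LinearMap.coe_toContinuousLinearMap', LinearMap.comp_apply, LinearMap.mulLeft_apply,
    LinearMap.mulRight_apply, Matrix.conjTranspose_add, Matrix.conjTranspose_smul,
    Matrix.conjTranspose_one, Complex.star_def, Complex.conj_ofReal, add_mul, mul_add, one_mul,
    mul_one, Matrix.smul_mul, Matrix.mul_smul, smul_sub, smul_add, smul_smul, sq, mul_assoc]
  rw [Set.mem_ofPred_eq]
  abel_nf

theorem trace_exp (t : ℝ) (ρ : Matrix (Fin d) (Fin d) ℂ) :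
    (NormedSpace.exp ((t : ℂ) • L) ρ).trace = ρ.trace := by
  have hd : ∀ s : ℝ, HasDerivAt (fun s : ℝ => traceCLM d (NormedSpace.exp ((s : ℂ) • L) ρ)) 0 s := by
    intro s
    have := ((traceCLM d).restrictScalars ℝ).hasFDerivAt.comp_hasDerivAt s
      (hasDerivAt_exp_smul' L ρ s)
    exact this.congr_deriv (hL.2 _)
  have := is_const_of_deriv_eq_zero (fun s => (hd s).differentiableAt) (fun s => (hd s).deriv) t 0
  simpa only [exp_zero_smul_apply, traceCLM_apply] using this

theorem isState_exp {t : ℝ} (ht : 0 ≤ t) {ρ : Matrix (Fin d) (Fin d) ℂ} (hρ : IsState ρ) :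
    IsState (NormedSpace.exp ((t : ℂ) • L) ρ) :=
  ⟨hL.posSemidef_exp ht hρ.1, (hL.trace_exp t ρ).trans hρ.2⟩

/-- Positivity and trace preservation keep the trace norms of the two Jordan parts. -/
theorem traceNorm_exp_le {t : ℝ} (ht : 0 ≤ t) {X : Matrix (Fin d) (Fin d) ℂ}
    (hX : X.IsHermitian) : traceNorm (NormedSpace.exp ((t : ℂ) • L) X) ≤ traceNorm X := by
  obtain ⟨P, N, hP, hN, rfl, h⟩ := exists_jordan_decomposition hX
  refine le_trans ?_ h
  rw [map_sub]
  refine (traceNorm_sub_le _ _).trans (add_le_add ?_ ?_)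
  · exact (traceNorm_le_trace_of_posSemidef (hL.posSemidef_exp ht hP)).trans_eq
      (congrArg Complex.re (hL.trace_exp t P))
  · exact (traceNorm_le_trace_of_posSemidef (hL.posSemidef_exp ht hN)).trans_eq
      (congrArg Complex.re (hL.trace_exp t N))

/-- Mean value inequality: the velocity `exp(sL)(L ρ)` never exceeds `L ρ` in trace norm. Pairing
with a contraction `W` makes the curve scalar. -/
theorem traceNorm_exp_sub_self_le {t : ℝ} (ht : 0 ≤ t) {ρ : Matrix (Fin d) (Fin d) ℂ}
    (hρ : ρ.IsHermitian) :
    traceNorm (NormedSpace.exp ((t : ℂ) • L) ρ - ρ) ≤ t * traceNorm (L ρ) := by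
  refine traceNorm_le_of_forall fun W hW => ?_
  have hd : ∀ s : ℝ, HasDerivAt
      (fun s : ℝ => traceMulCLM W (NormedSpace.exp ((s : ℂ) • L) ρ))
      (traceMulCLM W (NormedSpace.exp ((s : ℂ) • L) (L ρ))) s := fun s =>
    ((traceMulCLM W).restrictScalars ℝ).hasFDerivAt.comp_hasDerivAt s
      (hasDerivAt_exp_smul L ρ s)
  have h := norm_image_sub_le_of_norm_deriv_le_segment' (a := 0) (b := t)
    (C := traceNorm (L ρ)) (fun s _ => (hd s).hasDerivWithinAt)
    (fun s hs => (norm_trace_mul_le_traceNorm hW _).trans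
      (hL.traceNorm_exp_le hs.1 (hL.isHermitian_apply hρ))) t ⟨ht, le_rfl⟩
  rw [← map_sub, exp_zero_smul_apply, traceMulCLM_apply, sub_zero, mul_comm] at h
  exact h

/-- The halved distance is absorbed on the left, whence the factor 2; the rest is the drift of `ρ'`
up to time `t`. -/
theorem traceNorm_fixedPoint_sub_le {t : ℝ≥0} (ht : HalvesDistanceAt L t)
    {ρ ρ' : Matrix (Fin d) (Fin d) ℂ} (hρ : IsFixedPoint L ρ) (hρ' : IsState ρ') :
    traceNorm (ρ - ρ') ≤ 2 * t * traceNorm (L ρ') := by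
  have h1 := ht ρ ρ' hρ.1 hρ'
  have h2 := hL.traceNorm_exp_sub_self_le t.2 hρ'.1.1
  have h3 : ρ - ρ' = NormedSpace.exp (((t : ℝ) : ℂ) • L) (ρ - ρ') +
      (NormedSpace.exp (((t : ℝ) : ℂ) • L) ρ' - ρ') := by
    rw [map_sub, exp_smul_apply_eq_self hρ.2]; abel
  have h4 := traceNorm_add_le (NormedSpace.exp (((t : ℝ) : ℂ) • L) (ρ - ρ'))
    (NormedSpace.exp (((t : ℝ) : ℂ) • L) ρ' - ρ')
  rw [← h3] at h4
  change traceNorm (NormedSpace.exp (((t : ℝ) : ℂ) • L) ρ' - ρ') ≤ (t : ℝ) * _ at h2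
  linarith

end IsMarkovGenerator

theorem IsState.norm_le_one {ρ : Matrix (Fin d) (Fin d) ℂ} (hρ : IsState ρ) : ‖ρ‖ ≤ 1 := by
  obtain ⟨V, h₁, h₂, h₃⟩ := exists_spectral_decomposition hρ.1.1
  have hn := hρ.1.eigenvalues_nonneg
  have hs : ∑ i, hρ.1.1.eigenvalues i = 1 := by
    have h := hρ.1.1.trace_eq_sum_eigenvalues.symm.trans hρ.2
    rw [← Complex.ofReal_inj, Complex.ofReal_sum]
    exact h
  rw [h₃, norm_unitary_conj h₁ h₂, Matrix.l2_opNorm_diagonal]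
  refine (pi_norm_le_iff_of_nonneg zero_le_one).2 fun i => ?_
  rw [Complex.norm_real, Real.norm_eq_abs, abs_of_nonneg (hn i), ← hs]
  exact Finset.single_le_sum (fun j _ => hn j) (Finset.mem_univ i)

theorem isCompact_setOf_isState : IsCompact {ρ : Matrix (Fin d) (Fin d) ℂ | IsState ρ} := by
  have : ProperSpace (Matrix (Fin d) (Fin d) ℂ) := FiniteDimensional.proper ℂ _
  refine Metric.isCompact_of_isClosed_isBounded ?_ ?_
  · exact isClosed_posSemidef.inter (isClosed_eq (traceCLM d).continuous continuous_const)
  · exact (Metric.isBounded_closedBall (x := 0) (r := 1)).subset fun ρ hρ => by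
      simpa using IsState.norm_le_one hρ

/-- A Markov generator has a stationary state: a limit point of the time averages of any state. -/
theorem IsMarkovGenerator.exists_isFixedPoint {L : Superop d} (hL : IsMarkovGenerator L)
    {ρ₀ : Matrix (Fin d) (Fin d) ℂ} (hρ₀ : IsState ρ₀) : ∃ ρ, IsFixedPoint L ρ := by
  let T : ℝ → Matrix (Fin d) (Fin d) ℂ := fun s => NormedSpace.exp ((s : ℂ) • L) ρ₀
  have hT : ∀ s, HasDerivAt T (L (T s)) s := hasDerivAt_exp_smul' L ρ₀
  have hTc : Continuous T := continuous_iff_continuousAt.2 fun s => (hT s).continuousAt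
  let avg : ℕ → Matrix (Fin d) (Fin d) ℂ :=
    fun n => (((n + 1 : ℕ) : ℝ)⁻¹ : ℂ) • ∫ s in (0 : ℝ)..(n + 1 : ℕ), T s
  have hstate : ∀ n, IsState (avg n) := by
    intro n
    have hn : (0 : ℝ) ≤ (n + 1 : ℕ) := by positivity
    refine ⟨Matrix.PosSemidef.smul ?_ (by
      rw [← Complex.ofReal_inv]; exact_mod_cast inv_nonneg.2 hn), ?_⟩
    · rw [intervalIntegral.integral_of_le hn]
      refine posSemidef_integral ?_
      rw [MeasureTheory.ae_restrict_iff' measurableSet_Ioc]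
      exact Eventually.of_forall fun s hs => hL.posSemidef_exp hs.1.le hρ₀.1
    · have h1 := (traceCLM d).intervalIntegral_comp_comm
        (hTc.intervalIntegrable (μ := MeasureTheory.volume) 0 ((n + 1 : ℕ) : ℝ))
      have h2 : ∀ s, traceCLM d (T s) = 1 := fun s => (hL.trace_exp s ρ₀).trans hρ₀.2
      simp only [h2, intervalIntegral.integral_const, sub_zero, traceCLM_apply] at h1
      rw [Matrix.trace_smul, ← h1]
      have : ((n : ℂ) + 1) ≠ 0 := by exact_mod_cast Nat.succ_ne_zero n
      simp [this]
  -- By the fundamental theorem of calculus only the endpoints survive, and states are bounded, so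
  -- this tends to zero.
  have hLavg : ∀ n, L (avg n) = (((n + 1 : ℕ) : ℝ)⁻¹ : ℂ) • (T (n + 1 : ℕ) - ρ₀) := by
    intro n
    have h1 := L.intervalIntegral_comp_comm
      (hTc.intervalIntegrable (μ := MeasureTheory.volume) 0 ((n + 1 : ℕ) : ℝ))
    have h2 := intervalIntegral.integral_eq_sub_of_hasDerivAt (a := 0) (b := ((n + 1 : ℕ) : ℝ))
      (fun s _ => hT s) ((L.continuous.comp hTc).intervalIntegrable _ _)
    rw [map_smul, ← h1, h2]
    simp only [T, exp_zero_smul_apply]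
  obtain ⟨ρ, hρ, φ, hφ, hlim⟩ := isCompact_setOf_isState.tendsto_subseq hstate
  refine ⟨ρ, hρ, ?_⟩
  have h1 : Tendsto (fun n => L (avg n)) atTop (𝓝 0) := by
    have hb : Tendsto (fun n : ℕ => ((n + 1 : ℕ) : ℝ)⁻¹ * 2) atTop (𝓝 0) := by
      have := (tendsto_inv_atTop_nhds_zero_nat (𝕜 := ℝ)).comp (tendsto_add_atTop_nat 1)
      simpa using this.mul_const 2
    refine squeeze_zero_norm (fun n => ?_) hb
    rw [hLavg, norm_smul]
    refine mul_le_mul (le_of_eq ?_) ?_ (norm_nonneg _) (by positivity)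
    · rw [← Complex.ofReal_inv, Complex.norm_real, Real.norm_eq_abs, abs_of_nonneg (by positivity)]
    · refine (norm_sub_le _ _).trans ?_
      have h3 := (hL.isState_exp (t := (n + 1 : ℕ)) (by positivity) hρ₀).norm_le_one
      have h4 := hρ₀.norm_le_one
      linarith
  exact tendsto_nhds_unique ((L.continuous.tendsto ρ).comp hlim) (h1.comp hφ.tendsto_atTop)

end GibbsSampler

/-! ### Dissipators integrated over frequency. -/

namespace GibbsSampler

open MeasureTheory

variable {d : ℕ}

theorem integrable_weight_smul {F : Type*} [NormedAddCommGroup F] [NormedSpace ℂ F] {γ : ℝ → ℝ}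
    (hγ : Measurable γ) (hγ01 : ∀ ω, 0 ≤ γ ω ∧ γ ω ≤ 1) {Φ : ℝ → F} (hΦ : Continuous Φ)
    {b : ℝ → ℝ} (hb : Integrable b) (hle : ∀ ω, ‖Φ ω‖ ≤ b ω) :
    Integrable fun ω => (γ ω : ℂ) • Φ ω := by
  refine hb.mono' ((Complex.measurable_ofReal.comp hγ).aestronglyMeasurable.smul
    hΦ.aestronglyMeasurable) (Filter.Eventually.of_forall fun ω => ?_)
  rw [norm_smul, Complex.norm_real, Real.norm_eq_abs, abs_of_nonneg (hγ01 ω).1]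
  exact (mul_le_of_le_one_left (norm_nonneg _) (hγ01 ω).2).trans (hle ω)

theorem integrable_weight_smul_clm {E : Type*} [NormedAddCommGroup E] [NormedSpace ℂ E] {γ : ℝ → ℝ}
    (hγ : Measurable γ) (hγ01 : ∀ ω, 0 ≤ γ ω ∧ γ ω ≤ 1) {Φ : ℝ → E →L[ℂ] E} (hΦ : Continuous Φ)
    {b : ℝ → ℝ} (hb : Integrable b) (hle : ∀ ω, ‖Φ ω‖ ≤ b ω) :
    Integrable fun ω => (γ ω : ℂ) • Φ ω :=
  integrable_weight_smul hγ hγ01 hΦ hb hle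

theorem continuous_of_continuous_apply {X E : Type*} [TopologicalSpace X] [NormedAddCommGroup E]
    [NormedSpace ℂ E] [FiniteDimensional ℂ E] {f : X → E →L[ℂ] E}
    (h : ∀ x, Continuous fun y => f y x) : Continuous f :=
  continuous_clm_apply.2 h

theorem continuous_dissipator : Continuous (dissipator (d := d)) := by
  refine continuous_of_continuous_apply fun ρ => ?_
  have hs : Continuous fun K : Matrix (Fin d) (Fin d) ℂ => Kᴴ := continuous_id.matrix_conjTranspose
  have hm : Continuous fun K : Matrix (Fin d) (Fin d) ℂ => Kᴴ * K := hs.mul continuous_id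
  have h1 : Continuous fun K : Matrix (Fin d) (Fin d) ℂ => K * ρ * Kᴴ :=
    (continuous_id.mul continuous_const).mul hs
  have h2 : Continuous fun K : Matrix (Fin d) (Fin d) ℂ => Kᴴ * K * ρ + ρ * (Kᴴ * K) :=
    (hm.mul continuous_const).add (continuous_const.mul hm)
  have h3 : Continuous fun K : Matrix (Fin d) (Fin d) ℂ =>
      (1 / 2 : ℂ) • (Kᴴ * K * ρ + ρ * (Kᴴ * K)) := (continuous_const_smul (1 / 2 : ℂ)).comp h2
  exact h1.sub h3

theorem norm_conjTranspose_mul_le (K B : Matrix (Fin d) (Fin d) ℂ) : ‖Kᴴ * B‖ ≤ ‖K‖ * ‖B‖ :=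
  (norm_mul_le _ _).trans_eq (by rw [Matrix.l2_opNorm_conjTranspose])

theorem norm_sandwich_le (K ρ : Matrix (Fin d) (Fin d) ℂ) : ‖K * ρ * Kᴴ‖ ≤ ‖K‖ ^ 2 * ‖ρ‖ := by
  refine (norm_mul_le _ _).trans ?_
  rw [Matrix.l2_opNorm_conjTranspose]
  nlinarith [norm_mul_le K ρ, norm_nonneg K]

theorem norm_dissipator_le (K : Matrix (Fin d) (Fin d) ℂ) : ‖dissipator K‖ ≤ 2 * ‖K‖ ^ 2 := by
  refine ContinuousLinearMap.opNorm_le_bound _ (by positivity) fun ρ => ?_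
  have h1 := norm_sandwich_le K ρ
  have h0 := norm_conjTranspose_mul_le K K
  have h2 : ‖Kᴴ * K * ρ‖ ≤ ‖K‖ ^ 2 * ‖ρ‖ :=
    (norm_mul_le _ _).trans (by rw [sq]; gcongr)
  have h3 : ‖ρ * (Kᴴ * K)‖ ≤ ‖K‖ ^ 2 * ‖ρ‖ :=
    (norm_mul_le _ _).trans (by rw [mul_comm, sq]; gcongr)
  rw [dissipator_apply]
  refine (norm_sub_le _ _).trans ?_
  rw [norm_smul]
  have h4 := norm_add_le (Kᴴ * K * ρ) (ρ * (Kᴴ * K))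
  norm_num
  linarith

theorem trace_dissipator (K ρ : Matrix (Fin d) (Fin d) ℂ) : (dissipator K ρ).trace = 0 := by
  rw [dissipator_apply, Matrix.trace_sub, Matrix.trace_smul, Matrix.trace_add,
    Matrix.trace_mul_comm (K * ρ), ← mul_assoc, Matrix.trace_mul_comm ρ (Kᴴ * K), smul_eq_mul]
  ring

theorem integrable_sandwich {K : ℝ → Matrix (Fin d) (Fin d) ℂ} (hK : Continuous K)
    (hK2 : Integrable fun ω => ‖K ω‖ ^ 2) (σ : Matrix (Fin d) (Fin d) ℂ) :
    Integrable fun ω => K ω * σ * (K ω)ᴴ :=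
  (hK2.mul_const ‖σ‖).mono' ((hK.mul continuous_const).mul
    hK.matrix_conjTranspose).aestronglyMeasurable
    (Filter.Eventually.of_forall fun _ => norm_sandwich_le _ _)

theorem integrable_trace_sandwich {K : ℝ → Matrix (Fin d) (Fin d) ℂ} (hK : Continuous K)
    (hK2 : Integrable fun ω => ‖K ω‖ ^ 2) (σ : Matrix (Fin d) (Fin d) ℂ) :
    Integrable fun ω => (K ω * σ * (K ω)ᴴ).trace :=
  (traceCLM d).integrable_comp (integrable_sandwich hK hK2 σ)

section Generator

variable {m : ℕ} {γ : ℝ → ℝ} {K : Fin m → ℝ → Matrix (Fin d) (Fin d) ℂ}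

theorem integrable_weight_smul_dissipator (hγ : Measurable γ) (hγ01 : ∀ ω, 0 ≤ γ ω ∧ γ ω ≤ 1)
    (hK : ∀ a, Continuous (K a)) (hK2 : ∀ a, Integrable fun ω => ‖K a ω‖ ^ 2) (a : Fin m) :
    Integrable fun ω => (γ ω : ℂ) • dissipator (K a ω) :=
  integrable_weight_smul_clm hγ hγ01 (continuous_dissipator.comp (hK a)) ((hK2 a).const_mul 2)
    fun _ => norm_dissipator_le _

theorem sum_integral_dissipator_apply (hγ : Measurable γ) (hγ01 : ∀ ω, 0 ≤ γ ω ∧ γ ω ≤ 1)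
    (hK : ∀ a, Continuous (K a)) (hK2 : ∀ a, Integrable fun ω => ‖K a ω‖ ^ 2)
    (ρ : Matrix (Fin d) (Fin d) ℂ) :
    (∑ a, ∫ ω : ℝ, (γ ω : ℂ) • dissipator (K a ω) : Superop d) ρ =
      ∑ a, ∫ ω : ℝ, (γ ω : ℂ) • dissipator (K a ω) ρ := by
  rw [sum_apply]
  refine Finset.sum_congr rfl fun a _ => ?_
  exact ContinuousLinearMap.integral_apply
    (integrable_weight_smul_dissipator hγ hγ01 hK hK2 a) ρ

theorem integrable_weight_smul_dissipator_apply (hγ : Measurable γ)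
    (hγ01 : ∀ ω, 0 ≤ γ ω ∧ γ ω ≤ 1)
    (hK : ∀ a, Continuous (K a)) (hK2 : ∀ a, Integrable fun ω => ‖K a ω‖ ^ 2) (a : Fin m)
    (ρ : Matrix (Fin d) (Fin d) ℂ) :
    Integrable fun ω => (γ ω : ℂ) • dissipator (K a ω) ρ :=
  (integrable_weight_smul_dissipator hγ hγ01 hK hK2 a).apply_continuousLinearMap ρ

theorem trace_mul_sum_integral_dissipator (hγ : Measurable γ) (hγ01 : ∀ ω, 0 ≤ γ ω ∧ γ ω ≤ 1)
    (hK : ∀ a, Continuous (K a)) (hK2 : ∀ a, Integrable fun ω => ‖K a ω‖ ^ 2)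
    (W ρ : Matrix (Fin d) (Fin d) ℂ) :
    (W * (∑ a, ∫ ω : ℝ, (γ ω : ℂ) • dissipator (K a ω) : Superop d) ρ).trace =
      ∑ a, ∫ ω : ℝ, (γ ω : ℂ) * (W * dissipator (K a ω) ρ).trace := by
  rw [sum_integral_dissipator_apply hγ hγ01 hK hK2, ← traceMulCLM_apply, map_sum]
  refine Finset.sum_congr rfl fun a _ => ?_
  rw [← ContinuousLinearMap.integral_comp_comm _
    (integrable_weight_smul_dissipator_apply hγ hγ01 hK hK2 a ρ)]
  simp only [map_smul, traceMulCLM_apply, smul_eq_mul]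

/-- The positive part is `∑ ∫ γ K ρ Kᴴ`, and `G = -(1/2) ∑ ∫ γ Kᴴ K` is Hermitian, so the
anticommutator has the form `G ρ + ρ Gᴴ`. -/
theorem isMarkovGenerator_sum_integral_dissipator (hγ : Measurable γ)
    (hγ01 : ∀ ω, 0 ≤ γ ω ∧ γ ω ≤ 1)
    (hK : ∀ a, Continuous (K a)) (hK2 : ∀ a, Integrable fun ω => ‖K a ω‖ ^ 2) :
    IsMarkovGenerator (∑ a, ∫ ω : ℝ, (γ ω : ℂ) • dissipator (K a ω) : Superop d) := by
  constructor
  · have hG : ∀ a, (∫ ω : ℝ, (γ ω : ℂ) • ((K a ω)ᴴ * K a ω)).PosSemidef := fun a =>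
      posSemidef_integral (Filter.Eventually.of_forall fun ω =>
        (Matrix.posSemidef_conjTranspose_mul_self _).smul
          (show (0 : ℂ) ≤ γ ω by exact_mod_cast (hγ01 ω).1))
    have hGi : ∀ a, Integrable fun ω : ℝ => (γ ω : ℂ) • ((K a ω)ᴴ * K a ω) := fun a =>
      integrable_weight_smul hγ hγ01 (by have := hK a; fun_prop) (hK2 a)
        fun ω => (norm_conjTranspose_mul_le _ _).trans_eq (sq _).symm
    refine ⟨(-(1 / 2) : ℂ) • ∑ a, ∫ ω : ℝ, (γ ω : ℂ) • ((K a ω)ᴴ * K a ω), fun ρ hρ => ?_⟩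
    have hJi : ∀ a, Integrable fun ω : ℝ => (γ ω : ℂ) • (K a ω * ρ * (K a ω)ᴴ) := fun a =>
      integrable_weight_smul hγ hγ01 (by have := hK a; fun_prop) ((hK2 a).mul_const ‖ρ‖)
        fun ω => norm_sandwich_le _ _
    have hadj : ((-(1 / 2) : ℂ) • ∑ a, ∫ ω : ℝ, (γ ω : ℂ) • ((K a ω)ᴴ * K a ω))ᴴ =
        (-(1 / 2) : ℂ) • ∑ a, ∫ ω : ℝ, (γ ω : ℂ) • ((K a ω)ᴴ * K a ω) := by
      rw [Matrix.conjTranspose_smul, Matrix.conjTranspose_sum]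
      congr 1
      · simp
      · exact Finset.sum_congr rfl fun a _ => (hG a).1
    have hJ : (∑ a, ∫ ω : ℝ, (γ ω : ℂ) • (K a ω * ρ * (K a ω)ᴴ)).PosSemidef :=
      Matrix.posSemidef_sum _ fun a _ => posSemidef_integral (Filter.Eventually.of_forall fun ω =>
        (hρ.mul_mul_conjTranspose_same _).smul
          (show (0 : ℂ) ≤ γ ω by exact_mod_cast (hγ01 ω).1))
    convert hJ using 1
    rw [hadj, sum_integral_dissipator_apply hγ hγ01 hK hK2, sub_eq_iff_eq_add, Matrix.smul_mul,
      Matrix.mul_smul, ← smul_add, Finset.sum_mul, Finset.mul_sum, ← Finset.sum_add_distrib,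
      Finset.smul_sum, ← Finset.sum_add_distrib]
    refine Finset.sum_congr rfl fun a _ => ?_
    have hl := (LinearMap.toContinuousLinearMap (LinearMap.mulRight ℂ ρ)).integral_comp_comm (hGi a)
    have hr := (LinearMap.toContinuousLinearMap (LinearMap.mulLeft ℂ ρ)).integral_comp_comm (hGi a)
    have hli := (LinearMap.toContinuousLinearMap (LinearMap.mulRight ℂ ρ)).integrable_comp (hGi a)
    have hri := (LinearMap.toContinuousLinearMap (LinearMap.mulLeft ℂ ρ)).integrable_comp (hGi a)
    simp only [LinearMap.coe_toContinuousLinearMap', LinearMap.mulRight_apply,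
      LinearMap.mulLeft_apply] at hl hr hli hri
    have hsum := integral_add (hJi a) ((hli.add hri).smul (-(1 / 2) : ℂ))
    simp only [Pi.add_apply, Pi.smul_apply] at hsum
    rw [← hl, ← hr, ← integral_add hli hri, ← integral_smul, ← hsum]
    refine integral_congr_ae (Filter.Eventually.of_forall fun ω => ?_)
    simp only [dissipator_apply, Matrix.smul_mul, Matrix.mul_smul, smul_sub, smul_add, neg_smul,
      smul_comm (γ ω : ℂ) (1 / 2 : ℂ)]
    abel
  · intro ρ
    have := trace_mul_sum_integral_dissipator hγ hγ01 hK hK2 1 ρ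
    simpa only [one_mul, trace_dissipator, mul_zero, integral_zero, Finset.sum_const_zero] using this

end Generator

end GibbsSampler

/-! ### Schur multipliers in an energy eigenbasis and a Plancherel bound. -/

namespace GibbsSampler

open MeasureTheory

variable {d : ℕ}

/-- The Schur multiplier of `X` with symbol `g (E j - E k)` in the eigenbasis given by the columns
of `V`. -/
noncomputable def schurMul (V : Matrix (Fin d) (Fin d) ℂ) (E : Fin d → ℝ) (g : ℝ → ℂ)
    (X : Matrix (Fin d) (Fin d) ℂ) : Matrix (Fin d) (Fin d) ℂ :=
  V * Matrix.of (fun j k => g (E j - E k) * (Vᴴ * X * V) j k) * Vᴴ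

section Algebra

variable (V : Matrix (Fin d) (Fin d) ℂ) (E : Fin d → ℝ)

theorem schurMul_eq_sum (g : ℝ → ℂ) (X : Matrix (Fin d) (Fin d) ℂ) :
    schurMul V E g X = ∑ p : Fin d × Fin d,
      g (E p.1 - E p.2) • (V * Matrix.single p.1 p.2 ((Vᴴ * X * V) p.1 p.2) * Vᴴ) := by
  have h : Matrix.of (fun j k => g (E j - E k) * (Vᴴ * X * V) j k) =
      ∑ p : Fin d × Fin d, g (E p.1 - E p.2) •
        Matrix.single p.1 p.2 ((Vᴴ * X * V) p.1 p.2) := by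
    conv_lhs => rw [Matrix.matrix_eq_sum_single (Matrix.of _)]
    rw [Fintype.sum_prod_type]
    simp [Matrix.smul_single]
  rw [schurMul, h, Finset.mul_sum, Finset.sum_mul]
  simp only [Matrix.mul_smul, Matrix.smul_mul]

theorem conjTranspose_schurMul (g : ℝ → ℝ) (X : Matrix (Fin d) (Fin d) ℂ) :
    (schurMul V E (fun ν => (g ν : ℂ)) X)ᴴ = schurMul V E (fun ν => (g (-ν) : ℂ)) Xᴴ := by
  have h : (Matrix.of fun j k => (g (E j - E k) : ℂ) * (Vᴴ * X * V) j k)ᴴ =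
      Matrix.of fun j k => (g (-(E j - E k)) : ℂ) * (Vᴴ * Xᴴ * V) j k := by
    ext j k
    have h0 : (Vᴴ * X * V)ᴴ = Vᴴ * Xᴴ * V := by simp [Matrix.conjTranspose_mul, mul_assoc]
    change star ((g (E k - E j) : ℂ) * (Vᴴ * X * V) k j) = (g (-(E j - E k)) : ℂ) * _
    rw [← h0, star_mul', neg_sub, Complex.star_def, Complex.conj_ofReal]
    rfl
  rw [schurMul, schurMul, Matrix.conjTranspose_mul, Matrix.conjTranspose_mul, h,
    Matrix.conjTranspose_conjTranspose, ← mul_assoc]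

/-- A function of the Hamiltonian acts on entry `(j, k)` by a scalar from either side. For Gibbs
weights the ratio depends only on `E j - E k`, so it can be absorbed into the symbol. -/
theorem diagonal_mul_schurMul_eq (h₁ : Vᴴ * V = 1) (p : Fin d → ℂ) (g g' : ℝ → ℂ)
    (hg : ∀ j k, p j * g (E j - E k) = g' (E j - E k) * p k)
    (X : Matrix (Fin d) (Fin d) ℂ) :
    V * Matrix.diagonal p * Vᴴ * schurMul V E g X =
      schurMul V E g' X * (V * Matrix.diagonal p * Vᴴ) := by
  have key : ∀ Y Z : Matrix (Fin d) (Fin d) ℂ, V * Y * Vᴴ * (V * Z * Vᴴ) = V * (Y * Z) * Vᴴ := by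
    intro Y Z
    calc _ = V * Y * (Vᴴ * V) * Z * Vᴴ := by simp only [mul_assoc]
      _ = _ := by rw [h₁]; simp only [mul_assoc, mul_one]
  rw [schurMul, schurMul, key, key]
  congr 2
  ext j k
  rw [Matrix.diagonal_mul, Matrix.mul_diagonal, Matrix.of_apply, Matrix.of_apply, ← mul_assoc, hg]
  ring

theorem schurMul_sub (g g' : ℝ → ℂ) (X : Matrix (Fin d) (Fin d) ℂ) :
    schurMul V E (fun ν => g ν - g' ν) X = schurMul V E g X - schurMul V E g' X := by
  simp only [schurMul_eq_sum, sub_smul, Finset.sum_sub_distrib]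

theorem schurMul_const_mul (c : ℂ) (g : ℝ → ℂ) (X : Matrix (Fin d) (Fin d) ℂ) :
    schurMul V E (fun ν => c * g ν) X = c • schurMul V E g X := by
  simp only [schurMul_eq_sum, Finset.smul_sum, smul_smul]

theorem exp_smul_unitary_diagonal (h₁ : Vᴴ * V = 1) (h₂ : V * Vᴴ = 1) (z : ℂ) :
    NormedSpace.exp (z • (V * Matrix.diagonal (fun i => (E i : ℂ)) * Vᴴ)) =
      V * Matrix.diagonal (fun i => Complex.exp (z * E i)) * Vᴴ := by
  have hinv : V⁻¹ = Vᴴ := Matrix.inv_eq_right_inv h₂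
  have hU : IsUnit V := ⟨⟨V, Vᴴ, h₂, h₁⟩, rfl⟩
  have h3 : z • (V * Matrix.diagonal (fun i => (E i : ℂ)) * Vᴴ) =
      V * Matrix.diagonal (fun i => z * (E i : ℂ)) * V⁻¹ := by
    rw [hinv, ← Matrix.smul_mul, ← Matrix.mul_smul, ← Matrix.diagonal_smul]
    rfl
  rw [h3, Matrix.exp_conj _ _ hU, Matrix.exp_diagonal, hinv, Pi.exp_def]
  simp only [Complex.exp_eq_exp_ℂ]

theorem heisenberg_eq_schurMul (h₁ : Vᴴ * V = 1) (h₂ : V * Vᴴ = 1)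
    (X : Matrix (Fin d) (Fin d) ℂ) (t : ℝ) :
    heisenberg (V * Matrix.diagonal (fun i => (E i : ℂ)) * Vᴴ) X t =
      schurMul V E (fun ν => Complex.exp (Complex.I * t * ν)) X := by
  rw [heisenberg, exp_smul_unitary_diagonal V E h₁ h₂, exp_smul_unitary_diagonal V E h₁ h₂,
    schurMul]
  have h3 : Matrix.of (fun j k => Complex.exp (Complex.I * t * ((E j - E k : ℝ) : ℂ)) *
      (Vᴴ * X * V) j k) = Matrix.diagonal (fun i => Complex.exp (Complex.I * t * E i)) *
      (Vᴴ * X * V) * Matrix.diagonal (fun i => Complex.exp (-(Complex.I * t) * E i)) := by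
    ext j k
    have he : Complex.exp (Complex.I * t * ((E j - E k : ℝ) : ℂ)) =
        Complex.exp (Complex.I * t * E j) * Complex.exp (-(Complex.I * t) * E k) := by
      rw [← Complex.exp_add]
      congr 1
      push_cast; ring
    rw [Matrix.mul_diagonal, Matrix.diagonal_mul, Matrix.of_apply, he]
    ring
  rw [h3]
  simp only [mul_assoc]

theorem integral_smul_schurMul {G : ℝ → ℝ → ℂ} (X : Matrix (Fin d) (Fin d) ℂ)
    (hG : ∀ ν, Integrable fun t => G t ν) :
    ∫ t, schurMul V E (G t) X = schurMul V E (fun ν => ∫ t, G t ν) X := by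
  simp only [schurMul_eq_sum]
  rw [integral_finsetSum _ fun p _ => (hG _).smul_const _]
  simp only [integral_smul_const]

theorem trace_sandwich_unitary_conj (h₁ : Vᴴ * V = 1) (Y σ : Matrix (Fin d) (Fin d) ℂ) :
    (V * Y * Vᴴ * σ * (V * Y * Vᴴ)ᴴ).trace =
      ∑ j, ∑ l, ∑ k, Y j k * (Vᴴ * σ * V) k l * star (Y j l) := by
  have h : V * Y * Vᴴ * σ * (V * Y * Vᴴ)ᴴ = V * (Y * (Vᴴ * σ * V) * Yᴴ) * Vᴴ := by
    simp only [Matrix.conjTranspose_mul, Matrix.conjTranspose_conjTranspose, mul_assoc]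
  rw [h, trace_unitary_conj h₁]
  simp only [Matrix.trace, Matrix.diag_apply, Matrix.mul_apply (M := Y * (Vᴴ * σ * V)),
    Matrix.conjTranspose_apply, Matrix.mul_apply (M := Y), Finset.sum_mul]

end Algebra

section L2

variable {g : ℝ → ℝ} (hg : Continuous g) (hg2 : Integrable fun x => g x ^ 2)
include hg

theorem continuous_schurMul_sub (V : Matrix (Fin d) (Fin d) ℂ) (E : Fin d → ℝ)
    (X : Matrix (Fin d) (Fin d) ℂ) :
    Continuous fun ω : ℝ => schurMul V E (fun ν => (g (ω - ν) : ℂ)) X := by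
  simp only [schurMul_eq_sum]
  refine continuous_finsetSum _ fun p _ => ?_
  have h : Continuous fun ω : ℝ => (g (ω - (E p.1 - E p.2)) : ℂ) :=
    Complex.continuous_ofReal.comp (hg.comp (continuous_id.sub continuous_const))
  exact (continuous_id.smul continuous_const).comp h

include hg2

theorem integrable_mul_translate (a b : ℝ) : Integrable fun ω => g (ω + a) * g (ω + b) := by
  refine ((hg2.comp_add_right a).add (hg2.comp_add_right b)).mono'
    (by fun_prop) (Filter.Eventually.of_forall fun ω => ?_)
  rw [norm_mul, Real.norm_eq_abs, Real.norm_eq_abs, Pi.add_apply]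
  nlinarith [sq_nonneg (|g (ω + a)| - |g (ω + b)|), sq_abs (g (ω + a)), sq_abs (g (ω + b)),
    sq_nonneg (|g (ω + a)|), sq_nonneg (|g (ω + b)|)]

/-- The dimension-dependent bound is harmless: it gives integrability only and enters no estimate.
-/
theorem integrable_norm_sq_schurMul_sub (V : Matrix (Fin d) (Fin d) ℂ) (E : Fin d → ℝ)
    (X : Matrix (Fin d) (Fin d) ℂ) :
    Integrable fun ω : ℝ => ‖schurMul V E (fun ν => (g (ω - ν) : ℂ)) X‖ ^ 2 := by
  have hi : Integrable fun ω : ℝ => (Finset.univ : Finset (Fin d × Fin d)).card *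
      ∑ p : Fin d × Fin d, g (ω - (E p.1 - E p.2)) ^ 2 *
        ‖V * Matrix.single p.1 p.2 ((Vᴴ * X * V) p.1 p.2) * Vᴴ‖ ^ 2 :=
    (integrable_finsetSum _ fun p _ => (hg2.comp_sub_right _).mul_const _).const_mul _
  refine hi.mono' ((continuous_schurMul_sub hg V E X).norm.pow 2).aestronglyMeasurable
    (Filter.Eventually.of_forall fun ω => ?_)
  rw [Real.norm_eq_abs, abs_of_nonneg (by positivity), schurMul_eq_sum]
  refine (pow_le_pow_left₀ (norm_nonneg _) (norm_sum_le _ _) 2).trans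
    (sq_sum_le_card_mul_sum_sq.trans_eq ?_)
  congr 1
  refine Finset.sum_congr rfl fun p _ => ?_
  rw [norm_smul, mul_pow, Complex.norm_real, Real.norm_eq_abs, sq_abs]

/-- The averaged state `∫ D(ω) σ D(ω) dω`, `D(ω)` the diagonal matrix with entries `g (ω + E k)`,
is positive. -/
theorem posSemidef_autocorrelation_mul (E : Fin d → ℝ) {σ : Matrix (Fin d) (Fin d) ℂ}
    (hσ : σ.PosSemidef) :
    (Matrix.of fun k l => ((∫ ω, g (ω + E k) * g (ω + E l) : ℝ) : ℂ) * σ k l).PosSemidef := by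
  have h : Matrix.of (fun k l => ((∫ ω, g (ω + E k) * g (ω + E l) : ℝ) : ℂ) * σ k l) =
      ∫ ω, ∑ p : Fin d × Fin d, ((g (ω + E p.1) * g (ω + E p.2) : ℝ) : ℂ) •
        Matrix.single p.1 p.2 (σ p.1 p.2) := by
    rw [integral_finsetSum _ fun p _ =>
      ((integrable_mul_translate hg hg2 (E p.1) (E p.2)).ofReal (𝕜 := ℂ)).smul_const _]
    conv_lhs => rw [Matrix.matrix_eq_sum_single (Matrix.of _)]
    rw [Fintype.sum_prod_type]
    refine Finset.sum_congr rfl fun k _ => Finset.sum_congr rfl fun l _ => ?_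
    rw [integral_smul_const]
    erw [integral_ofReal]
    rw [Matrix.smul_single]
    rfl
  rw [h]
  refine posSemidef_integral (Filter.Eventually.of_forall fun ω => ?_)
  convert hσ.mul_mul_conjTranspose_same (Matrix.diagonal fun k => (g (ω + E k) : ℂ)) using 1
  rw [Fintype.sum_prod_type]
  conv_rhs => rw [Matrix.matrix_eq_sum_single (_ * _)]
  refine Finset.sum_congr rfl fun k _ => Finset.sum_congr rfl fun l _ => ?_
  rw [Matrix.smul_single, Matrix.diagonal_conjTranspose, Matrix.mul_diagonal, Matrix.diagonal_mul]
  congr 1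
  simp
  ring

/-- Integration over `ω` moves the filter from `X` onto `σ`: the row energy `E j` disappears by
translation, leaving an autocorrelation weight in `E k`, `E l`. -/
theorem integral_trace_schurMul_sandwich {V : Matrix (Fin d) (Fin d) ℂ} (h₁ : Vᴴ * V = 1)
    (h₂ : V * Vᴴ = 1) (E : Fin d → ℝ) (X σ : Matrix (Fin d) (Fin d) ℂ) :
    ∫ ω : ℝ, (schurMul V E (fun ν => (g (ω - ν) : ℂ)) X * σ *
        (schurMul V E (fun ν => (g (ω - ν) : ℂ)) X)ᴴ).trace =
      (X * (V * Matrix.of (fun k l => ((∫ ω, g (ω + E k) * g (ω + E l) : ℝ) : ℂ) *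
        (Vᴴ * σ * V) k l) * Vᴴ) * Xᴴ).trace := by
  have hX : X = V * (Vᴴ * X * V) * Vᴴ := by
    calc X = V * Vᴴ * X * (V * Vᴴ) := by rw [h₂, one_mul, mul_one]
      _ = _ := by simp only [mul_assoc]
  set Y := Vᴴ * X * V
  set τ := Vᴴ * σ * V
  have hS : ∀ S : Matrix (Fin d) (Fin d) ℂ, Vᴴ * (V * S * Vᴴ) * V = S := fun S => by
    calc _ = Vᴴ * V * S * (Vᴴ * V) := by simp only [mul_assoc]
      _ = _ := by rw [h₁, one_mul, mul_one]
  rw [hX, trace_sandwich_unitary_conj V h₁, hS]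
  simp only [schurMul]
  simp only [trace_sandwich_unitary_conj V h₁, hS, Matrix.of_apply]
  have hint : ∀ j l k, Integrable fun ω : ℝ => (g (ω - (E j - E k)) : ℂ) * Y j k * τ k l *
      star ((g (ω - (E j - E l)) : ℂ) * Y j l) := by
    intro j l k
    have := (((integrable_mul_translate hg hg2 (-(E j - E k)) (-(E j - E l))).ofReal
      (𝕜 := ℂ)).mul_const (Y j k * τ k l * star (Y j l)))
    refine this.congr (Filter.Eventually.of_forall fun ω => ?_)
    simp [sub_eq_add_neg]
    ring
  rw [integral_finsetSum _ fun j _ => integrable_finsetSum _ fun l _ =>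
    integrable_finsetSum _ fun k _ => hint j l k]
  refine Finset.sum_congr rfl fun j _ => ?_
  rw [integral_finsetSum _ fun l _ => integrable_finsetSum _ fun k _ => hint j l k]
  refine Finset.sum_congr rfl fun l _ => ?_
  rw [integral_finsetSum _ fun k _ => hint j l k]
  refine Finset.sum_congr rfl fun k _ => ?_
  have h3 : ∫ ω, g (ω + E k) * g (ω + E l) =
      ∫ ω, g (ω - (E j - E k)) * g (ω - (E j - E l)) := by
    rw [← integral_sub_right_eq_self (fun ω => g (ω + E k) * g (ω + E l)) (E j)]
    simp only [sub_sub_eq_add_sub, sub_add_eq_add_sub]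
  rw [h3, ← integral_complex_ofReal]
  calc _ = ∫ ω, ((g (ω - (E j - E k)) * g (ω - (E j - E l)) : ℝ) : ℂ) *
        (Y j k * τ k l * star (Y j l)) := by
        congr 1; ext ω; simp; ring
    _ = _ := by rw [integral_mul_const]; ring

/-- Plancherel type bound for a family of operators with filter `g`. -/
theorem sum_integral_trace_schurMul_sandwich_le {V : Matrix (Fin d) (Fin d) ℂ} (h₁ : Vᴴ * V = 1)
    (h₂ : V * Vᴴ = 1) (E : Fin d → ℝ) {m : ℕ} (A : Fin m → Matrix (Fin d) (Fin d) ℂ)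
    {σ : Matrix (Fin d) (Fin d) ℂ} (hσ : σ.PosSemidef) :
    ∑ a, ∫ ω : ℝ, (schurMul V E (fun ν => (g (ω - ν) : ℂ)) (A a) * σ *
        (schurMul V E (fun ν => (g (ω - ν) : ℂ)) (A a))ᴴ).trace.re ≤
      ‖∑ a, (A a)ᴴ * A a‖ * ((∫ x, g x ^ 2) * σ.trace.re) := by
  have hτ : (Vᴴ * σ * V).PosSemidef := hσ.conjTranspose_mul_mul_same V
  set S := Matrix.of (fun k l => ((∫ ω, g (ω + E k) * g (ω + E l) : ℝ) : ℂ) *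
        (Vᴴ * σ * V) k l) with hSdef
  have hS : S.PosSemidef := posSemidef_autocorrelation_mul hg hg2 E hτ
  have hStr : (V * S * Vᴴ).trace.re = (∫ x, g x ^ 2) * σ.trace.re := by
    have h3 : (Vᴴ * σ * V).trace = σ.trace := by
      rw [Matrix.trace_mul_comm, ← mul_assoc, h₂, one_mul]
    -- On the diagonal the autocorrelation is constant, so the averaged state has trace `∫ g²` times
    -- that of `σ`.
    have h4 : ∀ k, ∫ ω, g (ω + E k) * g (ω + E k) = ∫ x, g x ^ 2 := fun k => by
      simp only [← sq]
      exact integral_add_right_eq_self (fun ω => g ω ^ 2) (E k)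
    rw [trace_unitary_conj h₁, ← h3]
    simp only [hSdef, Matrix.trace, Matrix.diag_apply, Matrix.of_apply, h4, ← Finset.mul_sum,
      Complex.re_ofReal_mul]
  have hint : ∀ a, Integrable fun ω : ℝ => (schurMul V E (fun ν => (g (ω - ν) : ℂ)) (A a) * σ *
        (schurMul V E (fun ν => (g (ω - ν) : ℂ)) (A a))ᴴ).trace := fun a =>
    integrable_trace_sandwich (continuous_schurMul_sub hg V E (A a))
      (integrable_norm_sq_schurMul_sub hg hg2 V E (A a)) σ
  have hre : ∀ a, ∫ ω : ℝ, (schurMul V E (fun ν => (g (ω - ν) : ℂ)) (A a) * σ *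
        (schurMul V E (fun ν => (g (ω - ν) : ℂ)) (A a))ᴴ).trace.re =
      (((A a)ᴴ * A a) * (V * S * Vᴴ)).trace.re := by
    intro a
    have h5 := Complex.reCLM.integral_comp_comm (hint a)
    rw [integral_trace_schurMul_sandwich hg hg2 h₁ h₂] at h5
    refine h5.trans ?_
    rw [Complex.reCLM_apply, Matrix.trace_mul_comm (_ * _), ← mul_assoc]
  rw [Finset.sum_congr rfl fun a _ => hre a, ← Complex.re_sum, ← Matrix.trace_sum,
    ← Finset.sum_mul, ← hStr]
  exact (Complex.re_le_norm _).trans (norm_trace_mul_le_of_posSemidef _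
    (hS.mul_mul_conjTranspose_same V))

end L2

end GibbsSampler

/-! ### Bounds on the residual `L ρ`. -/

namespace GibbsSampler

open MeasureTheory

variable {d : ℕ}

/-- Entrywise Young inequality. This form, unlike a product of square roots, can be integrated and
summed directly; `l` is tuned at the end. -/
theorem norm_trace_conjTranspose_mul_le (M N : Matrix (Fin d) (Fin d) ℂ) {l : ℝ} (hl : 0 < l) :
    ‖(Nᴴ * M).trace‖ ≤ 1 / 2 * (l * (N * Nᴴ).trace.re + l⁻¹ * (M * Mᴴ).trace.re) := by
  rw [trace_mul_conjTranspose_self_re, trace_mul_conjTranspose_self_re, Finset.mul_sum,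
    Finset.mul_sum, ← Finset.sum_add_distrib, Finset.mul_sum, Matrix.trace]
  simp only [Matrix.diag_apply, Matrix.mul_apply, Matrix.conjTranspose_apply]
  rw [Finset.sum_comm]
  refine (norm_sum_le _ _).trans (Finset.sum_le_sum fun i _ => (norm_sum_le _ _).trans ?_)
  rw [Finset.mul_sum, Finset.mul_sum, ← Finset.sum_add_distrib, Finset.mul_sum]
  refine Finset.sum_le_sum fun j _ => ?_
  rw [norm_mul, norm_star]
  have h1 : 0 ≤ l⁻¹ * (l * ‖N i j‖ - ‖M i j‖) ^ 2 := by positivity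
  have h2 : l⁻¹ * (l * ‖N i j‖ - ‖M i j‖) ^ 2 =
      l * ‖N i j‖ ^ 2 + l⁻¹ * ‖M i j‖ ^ 2 - 2 * (‖N i j‖ * ‖M i j‖) := by
    field_simp; ring
  linarith

theorem exists_eq_mul_conjTranspose {ρ : Matrix (Fin d) (Fin d) ℂ} (hρ : ρ.PosSemidef) :
    ∃ R : Matrix (Fin d) (Fin d) ℂ, ρ = R * Rᴴ := by
  open scoped MatrixOrder in
  obtain ⟨x, hx⟩ := CStarAlgebra.nonneg_iff_eq_star_mul_self.1 hρ.nonneg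
  exact ⟨xᴴ, by rw [Matrix.conjTranspose_conjTranspose]; exact hx⟩

/-- Weighted Cauchy–Schwarz inequality for the inner product defined by a state. -/
theorem norm_trace_mul_conjTranspose_mul_mul_le {ρ : Matrix (Fin d) (Fin d) ℂ} (hρ : ρ.PosSemidef)
    (W K B : Matrix (Fin d) (Fin d) ℂ) {l : ℝ} (hl : 0 < l) :
    ‖(W * (Kᴴ * B * ρ)).trace‖ ≤
      1 / 2 * (l * (K * (Wᴴ * ρ * W) * Kᴴ).trace.re + l⁻¹ * (B * ρ * Bᴴ).trace.re) := by
  obtain ⟨R, rfl⟩ := exists_eq_mul_conjTranspose hρ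
  convert norm_trace_conjTranspose_mul_le (B * R) (K * Wᴴ * R) hl using 2
  · rw [show W * (Kᴴ * B * (R * Rᴴ)) = W * Kᴴ * B * R * Rᴴ by simp only [mul_assoc],
      Matrix.trace_mul_comm]
    simp only [Matrix.conjTranspose_mul, Matrix.conjTranspose_conjTranspose, mul_assoc]
  · simp only [Matrix.conjTranspose_mul, Matrix.conjTranspose_conjTranspose, mul_assoc]

theorem norm_trace_mul_mul_conjTranspose_mul_le {ρ : Matrix (Fin d) (Fin d) ℂ} (hρ : ρ.PosSemidef)
    (W K B : Matrix (Fin d) (Fin d) ℂ) {l : ℝ} (hl : 0 < l) :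
    ‖(W * (ρ * (Bᴴ * K))).trace‖ ≤
      1 / 2 * (l * (K * (W * ρ * Wᴴ) * Kᴴ).trace.re + l⁻¹ * (B * ρ * Bᴴ).trace.re) := by
  have h := norm_trace_mul_conjTranspose_mul_mul_le hρ Wᴴ K B hl
  rw [Matrix.conjTranspose_conjTranspose] at h
  have h2 : (W * (ρ * (Bᴴ * K))).trace = star (Wᴴ * (Kᴴ * B * ρ)).trace := by
    rw [← Matrix.trace_conjTranspose]
    simp only [Matrix.conjTranspose_mul, Matrix.conjTranspose_conjTranspose]
    rw [Matrix.trace_mul_comm, hρ.1.eq]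
  rwa [h2, norm_star]

theorem trace_conj_contraction_le {ρ W : Matrix (Fin d) (Fin d) ℂ} (hρ : IsState ρ)
    (hW : ‖W‖ ≤ 1) : (W * ρ * Wᴴ).trace.re ≤ 1 := by
  rw [Matrix.trace_mul_comm, ← mul_assoc]
  refine (Complex.re_le_norm _).trans ((norm_trace_mul_le_of_posSemidef _ hρ.1).trans ?_)
  rw [hρ.2, Complex.one_re, mul_one]
  refine (norm_conjTranspose_mul_le _ _).trans ?_
  nlinarith [norm_nonneg W]

section Residual

variable {m : ℕ} {γ : ℝ → ℝ} {K : Fin m → ℝ → Matrix (Fin d) (Fin d) ℂ}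
  {ρ : Matrix (Fin d) (Fin d) ℂ}

/-- The bound for the regime `σ ≤ β`, which needs no detailed balance. -/
theorem traceNorm_sum_integral_dissipator_le_two (hγ : Measurable γ)
    (hγ01 : ∀ ω, 0 ≤ γ ω ∧ γ ω ≤ 1)
    (hK : ∀ a, Continuous (K a)) (hK2 : ∀ a, Integrable fun ω => ‖K a ω‖ ^ 2)
    (hKσ : ∀ σ : Matrix (Fin d) (Fin d) ℂ, σ.PosSemidef →
      ∑ a, ∫ ω : ℝ, (K a ω * σ * (K a ω)ᴴ).trace.re ≤ σ.trace.re)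
    (hρ : IsState ρ) :
    traceNorm ((∑ a, ∫ ω : ℝ, (γ ω : ℂ) • dissipator (K a ω) : Superop d) ρ) ≤ 2 := by
  refine traceNorm_le_of_forall fun W hW => ?_
  rw [trace_mul_sum_integral_dissipator hγ hγ01 hK hK2]
  have hWt : ‖Wᴴ‖ ≤ 1 := by rwa [Matrix.l2_opNorm_conjTranspose]
  have hp1 := hρ.1.conjTranspose_mul_mul_same W
  have hp2 := hρ.1.mul_mul_conjTranspose_same W
  have hb1 := (hKσ _ hp1).trans (by simpa using trace_conj_contraction_le hρ hWt)
  have hb2 := (hKσ _ hp2).trans (trace_conj_contraction_le hρ hW)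
  have hb0 := (hKσ _ hρ.1).trans_eq (by rw [hρ.2, Complex.one_re])
  have hi : ∀ (σ : Matrix (Fin d) (Fin d) ℂ) a,
      Integrable fun ω => (K a ω * σ * (K a ω)ᴴ).trace.re := fun σ a =>
    (integrable_trace_sandwich (hK a) (hK2 a) σ).re
  -- The jump contributes `1` and the two anticommutator halves `1/4 + 1/4` each; the coefficients
  -- sum to `2`.
  have hpt : ∀ a ω, ‖(γ ω : ℂ) * (W * dissipator (K a ω) ρ).trace‖ ≤
      3 / 2 * (K a ω * ρ * (K a ω)ᴴ).trace.re + (1 / 4 * (K a ω * (Wᴴ * ρ * W) * (K a ω)ᴴ).trace.re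
        + 1 / 4 * (K a ω * (W * ρ * Wᴴ) * (K a ω)ᴴ).trace.re) := by
    intro a ω
    have h1 := norm_trace_mul_conjTranspose_mul_mul_le hρ.1 W (K a ω) (K a ω) one_pos
    have h2 := norm_trace_mul_mul_conjTranspose_mul_le hρ.1 W (K a ω) (K a ω) one_pos
    have hp := hρ.1.mul_mul_conjTranspose_same (K a ω)
    have h3 := (norm_trace_mul_le_of_posSemidef W hp).trans
      (mul_le_of_le_one_left (Complex.nonneg_iff.1 hp.trace_nonneg).1 hW)
    rw [norm_mul, Complex.norm_real, Real.norm_eq_abs, abs_of_nonneg (hγ01 ω).1]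
    refine (mul_le_of_le_one_left (norm_nonneg _) (hγ01 ω).2).trans ?_
    rw [dissipator_apply, mul_sub, Matrix.mul_smul, mul_add, Matrix.trace_sub, Matrix.trace_smul,
      Matrix.trace_add]
    refine (norm_sub_le _ _).trans ?_
    rw [norm_smul]
    have h4 := norm_add_le (W * ((K a ω)ᴴ * K a ω * ρ)).trace (W * (ρ * ((K a ω)ᴴ * K a ω))).trace
    norm_num at h1 h2 ⊢
    linarith
  refine (norm_sum_le _ _).trans ((Finset.sum_le_sum fun a _ =>
    (norm_integral_le_of_norm_le (((hi ρ a).const_mul _).add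
      (((hi _ a).const_mul _).add ((hi _ a).const_mul _)))
      (Filter.Eventually.of_forall (hpt a)))).trans ?_)
  have hsplit : ∀ a, ∫ ω, ((fun ω => 3 / 2 * (K a ω * ρ * (K a ω)ᴴ).trace.re) +
      ((fun ω => 1 / 4 * (K a ω * (Wᴴ * ρ * W) * (K a ω)ᴴ).trace.re) +
        fun ω => 1 / 4 * (K a ω * (W * ρ * Wᴴ) * (K a ω)ᴴ).trace.re)) ω =
      3 / 2 * (∫ ω, (K a ω * ρ * (K a ω)ᴴ).trace.re) +
      (1 / 4 * (∫ ω, (K a ω * (Wᴴ * ρ * W) * (K a ω)ᴴ).trace.re)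
        + 1 / 4 * ∫ ω, (K a ω * (W * ρ * Wᴴ) * (K a ω)ᴴ).trace.re) := by
    intro a
    rw [integral_add' ((hi ρ a).const_mul _) (((hi _ a).const_mul _).add ((hi _ a).const_mul _)),
      integral_add' ((hi _ a).const_mul _) ((hi _ a).const_mul _), integral_const_mul,
      integral_const_mul, integral_const_mul]
  rw [Finset.sum_congr rfl fun a _ => hsplit a, Finset.sum_add_distrib, Finset.sum_add_distrib,
    ← Finset.mul_sum, ← Finset.mul_sum, ← Finset.mul_sum]
  linarith

/-- The residual of approximate detailed balance: `B` measures the failure of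
`γ(-ω) ρ K(ω) = γ(ω) K(ω) ρ`. -/
theorem traceNorm_sum_integral_dissipator_le {B : Fin m → ℝ → Matrix (Fin d) (Fin d) ℂ}
    (hγ : Measurable γ) (hγ01 : ∀ ω, 0 ≤ γ ω ∧ γ ω ≤ 1)
    (hK : ∀ a, Continuous (K a)) (hK2 : ∀ a, Integrable fun ω => ‖K a ω‖ ^ 2)
    (hB : ∀ a, Continuous (B a)) (hB2 : ∀ a, Integrable fun ω => ‖B a ω‖ ^ 2)
    (hKσ : ∀ σ : Matrix (Fin d) (Fin d) ℂ, σ.PosSemidef →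
      ∑ a, ∫ ω : ℝ, (K a ω * σ * (K a ω)ᴴ).trace.re ≤ σ.trace.re)
    (hρ : IsState ρ) {κ : ℝ} (hκ : 0 < κ)
    (hBρ : ∑ a, ∫ ω : ℝ, (B a ω * ρ * (B a ω)ᴴ).trace.re ≤ κ ^ 2)
    (τ : Equiv.Perm (Fin m)) (hτ : ∀ a ω, (K a ω)ᴴ = K (τ a) (-ω))
    (hdb : ∀ a ω, (γ (-ω) : ℂ) • (ρ * K a ω) =
      (γ ω : ℂ) • (K a ω * ρ) + (γ ω : ℂ) • (B a ω * ρ)) :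
    traceNorm ((∑ a, ∫ ω : ℝ, (γ ω : ℂ) • dissipator (K a ω) : Superop d) ρ) ≤ κ := by
  refine traceNorm_le_of_forall fun W hW => ?_
  rw [trace_mul_sum_integral_dissipator hγ hγ01 hK hK2]
  have hWt : ‖Wᴴ‖ ≤ 1 := by rwa [Matrix.l2_opNorm_conjTranspose]
  have hp1 := hρ.1.conjTranspose_mul_mul_same W
  have hp2 := hρ.1.mul_mul_conjTranspose_same W
  have hb1 := (hKσ _ hp1).trans (by simpa using trace_conj_contraction_le hρ hWt)
  have hb2 := (hKσ _ hp2).trans (trace_conj_contraction_le hρ hW)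
  have hi : ∀ (σ : Matrix (Fin d) (Fin d) ℂ) a,
      Integrable fun ω => (K a ω * σ * (K a ω)ᴴ).trace.re := fun σ a =>
    (integrable_trace_sandwich (hK a) (hK2 a) σ).re
  have hiB : ∀ a, Integrable fun ω => (B a ω * ρ * (B a ω)ᴴ).trace.re := fun a =>
    (integrable_trace_sandwich (hB a) (hB2 a) ρ).re
  let jump : Fin m → ℝ → ℂ := fun a ω => (γ ω : ℂ) * (W * (K a ω * ρ * (K a ω)ᴴ)).trace
  let jump' : Fin m → ℝ → ℂ := fun a ω => (γ (-ω) : ℂ) * (W * ((K a ω)ᴴ * ρ * K a ω)).trace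
  let decay : Fin m → ℝ → ℂ := fun a ω => (γ ω : ℂ) * (1 / 2 *
    ((W * ((K a ω)ᴴ * K a ω * ρ)).trace + (W * (ρ * ((K a ω)ᴴ * K a ω))).trace))
  have hjump : ∀ a, Integrable (jump a) := by
    intro a
    have h := (traceMulCLM W).integrable_comp (integrable_weight_smul hγ hγ01
      (Φ := fun ω => K a ω * ρ * (K a ω)ᴴ) (((hK a).mul continuous_const).mul (hK a).matrix_conjTranspose)
      ((hK2 a).mul_const ‖ρ‖) fun ω => norm_sandwich_le (K a ω) ρ)
    simpa only [map_smul, traceMulCLM_apply, smul_eq_mul] using h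
  have hdiss : ∀ a ω, (γ ω : ℂ) * (W * dissipator (K a ω) ρ).trace = jump a ω - decay a ω := by
    intro a ω
    simp only [jump, decay, dissipator_apply, mul_sub, Matrix.mul_smul, mul_add,
      Matrix.trace_sub, Matrix.trace_smul, Matrix.trace_add, smul_eq_mul]
  have htot : ∀ a, Integrable fun ω => (γ ω : ℂ) * (W * dissipator (K a ω) ρ).trace := by
    intro a
    have h := (traceMulCLM W).integrable_comp
      (integrable_weight_smul_dissipator_apply hγ hγ01 hK hK2 a ρ)
    simpa only [map_smul, traceMulCLM_apply, smul_eq_mul] using h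
  have hdecay : ∀ a, Integrable (decay a) := fun a =>
    ((hjump a).sub (htot a)).congr (Filter.Eventually.of_forall fun ω => by
      simp only [Pi.sub_apply, hdiss]; ring)
  -- Adjoint closure enters here: relabelling jumps and reflecting frequency turns `K ρ Kᴴ` into `Kᴴ
  -- ρ K` with weight `γ(-ω)`, the form to which detailed balance applies.
  have hrefl : ∀ a ω, jump' (τ a) (-ω) = jump a ω := by
    intro a ω
    simp only [jump, jump', neg_neg, ← hτ, Matrix.conjTranspose_conjTranspose]
  have hjump' : ∀ a, Integrable (jump' a) := by
    intro a
    have h := (hjump (τ.symm a)).comp_neg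
    refine h.congr (Filter.Eventually.of_forall fun ω => ?_)
    change jump (τ.symm a) (-ω) = _
    rw [← hrefl, Equiv.apply_symm_apply, neg_neg]
  have hsymm : ∑ a, ∫ ω, jump a ω = ∑ a, ∫ ω, jump' a ω := by
    rw [← Equiv.sum_comp τ fun a => ∫ ω, jump' a ω]
    refine Finset.sum_congr rfl fun a _ => ?_
    rw [← integral_neg_eq_self (jump' (τ a))]
    simp only [hrefl]
  have hsum : ∑ a, ∫ ω, (γ ω : ℂ) * (W * dissipator (K a ω) ρ).trace =
      ∑ a, ∫ ω, (jump' a ω - decay a ω) := by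
    simp only [hdiss]
    rw [Finset.sum_congr rfl fun a _ => integral_sub (hjump a) (hdecay a),
      Finset.sum_congr rfl fun a _ => integral_sub (hjump' a) (hdecay a),
      Finset.sum_sub_distrib, Finset.sum_sub_distrib, hsymm]
  -- Detailed balance is applied to `ρ K` and, in adjoint form, to `Kᴴ ρ`. The average of the two
  -- cancels the anticommutator and leaves terms linear in `B`.
  have hres : ∀ a ω, jump' a ω - decay a ω = (γ ω : ℂ) * (1 / 2 *
      ((W * ((K a ω)ᴴ * B a ω * ρ)).trace + (W * (ρ * ((B a ω)ᴴ * K a ω))).trace)) := by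
    intro a ω
    have hdb' : (γ (-ω) : ℂ) • ((K a ω)ᴴ * ρ) =
        (γ ω : ℂ) • (ρ * (K a ω)ᴴ) + (γ ω : ℂ) • (ρ * (B a ω)ᴴ) := by
      have := congrArg Matrix.conjTranspose (hdb a ω)
      simpa only [Matrix.conjTranspose_add, Matrix.conjTranspose_smul, Matrix.conjTranspose_mul,
        hρ.1.1.eq, Complex.star_def, Complex.conj_ofReal] using this
    have e1 : (γ (-ω) : ℂ) * (W * ((K a ω)ᴴ * ρ * K a ω)).trace =
        (γ ω : ℂ) * (W * ((K a ω)ᴴ * K a ω * ρ)).trace +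
          (γ ω : ℂ) * (W * ((K a ω)ᴴ * B a ω * ρ)).trace := by
      have := congrArg (fun X => (W * ((K a ω)ᴴ * X)).trace) (hdb a ω)
      simpa only [mul_add, Matrix.mul_smul, Matrix.trace_add, Matrix.trace_smul, smul_eq_mul,
        mul_assoc] using this
    have e2 : (γ (-ω) : ℂ) * (W * ((K a ω)ᴴ * ρ * K a ω)).trace =
        (γ ω : ℂ) * (W * (ρ * ((K a ω)ᴴ * K a ω))).trace +
          (γ ω : ℂ) * (W * (ρ * ((B a ω)ᴴ * K a ω))).trace := by
      have := congrArg (fun X => (W * (X * K a ω)).trace) hdb'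
      simpa only [mul_add, add_mul, Matrix.mul_smul, Matrix.smul_mul, Matrix.trace_add,
        Matrix.trace_smul, smul_eq_mul, mul_assoc] using this
    simp only [jump', decay]
    linear_combination (1 / 2 : ℂ) * e1 + (1 / 2 : ℂ) * e2
  -- Young weight `l = κ` balances the sides: the `B` term integrates to at most `κ/2`, the two `K`
  -- terms to `κ/4` each.
  have hpt : ∀ a ω, ‖jump' a ω - decay a ω‖ ≤ κ⁻¹ / 2 * (B a ω * ρ * (B a ω)ᴴ).trace.re +
      (κ / 4 * (K a ω * (Wᴴ * ρ * W) * (K a ω)ᴴ).trace.re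
        + κ / 4 * (K a ω * (W * ρ * Wᴴ) * (K a ω)ᴴ).trace.re) := by
    intro a ω
    have h1 := norm_trace_mul_conjTranspose_mul_mul_le hρ.1 W (K a ω) (B a ω) hκ
    have h2 := norm_trace_mul_mul_conjTranspose_mul_le hρ.1 W (K a ω) (B a ω) hκ
    rw [hres, norm_mul, Complex.norm_real, Real.norm_eq_abs, abs_of_nonneg (hγ01 ω).1]
    refine (mul_le_of_le_one_left (norm_nonneg _) (hγ01 ω).2).trans ?_
    rw [norm_mul]
    have h4 := norm_add_le (W * ((K a ω)ᴴ * B a ω * ρ)).trace (W * (ρ * ((B a ω)ᴴ * K a ω))).trace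
    norm_num
    linarith
  rw [hsum]
  refine (norm_sum_le _ _).trans ((Finset.sum_le_sum fun a _ =>
    (norm_integral_le_of_norm_le (((hiB a).const_mul _).add
      (((hi _ a).const_mul _).add ((hi _ a).const_mul _)))
      (Filter.Eventually.of_forall (hpt a)))).trans ?_)
  have hsplit : ∀ a, ∫ ω, ((fun ω => κ⁻¹ / 2 * (B a ω * ρ * (B a ω)ᴴ).trace.re) +
      ((fun ω => κ / 4 * (K a ω * (Wᴴ * ρ * W) * (K a ω)ᴴ).trace.re) +
        fun ω => κ / 4 * (K a ω * (W * ρ * Wᴴ) * (K a ω)ᴴ).trace.re)) ω =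
      κ⁻¹ / 2 * (∫ ω, (B a ω * ρ * (B a ω)ᴴ).trace.re) +
      (κ / 4 * (∫ ω, (K a ω * (Wᴴ * ρ * W) * (K a ω)ᴴ).trace.re)
        + κ / 4 * ∫ ω, (K a ω * (W * ρ * Wᴴ) * (K a ω)ᴴ).trace.re) := by
    intro a
    rw [integral_add' ((hiB a).const_mul _) (((hi _ a).const_mul _).add ((hi _ a).const_mul _)),
      integral_add' ((hi _ a).const_mul _) ((hi _ a).const_mul _), integral_const_mul,
      integral_const_mul, integral_const_mul]
  rw [Finset.sum_congr rfl fun a _ => hsplit a, Finset.sum_add_distrib, Finset.sum_add_distrib,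
    ← Finset.mul_sum, ← Finset.mul_sum, ← Finset.mul_sum]
  have hBκ := mul_le_mul_of_nonneg_left hBρ (show 0 ≤ κ⁻¹ / 2 by positivity)
  have h1 := mul_le_mul_of_nonneg_left hb1 (show 0 ≤ κ / 4 by positivity)
  have h2 := mul_le_mul_of_nonneg_left hb2 (show 0 ≤ κ / 4 by positivity)
  have h3 : κ⁻¹ / 2 * κ ^ 2 = κ / 2 := by field_simp
  linarith

end Residual

end GibbsSampler

/-! ### Gaussian integrals and the filter's Fourier transform. -/

namespace GibbsSampler

open MeasureTheory

section Gaussian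

theorem exp_quadratic_eq {b : ℝ} (hb : 0 < b) (a x : ℝ) :
    Real.exp (-b * x ^ 2 + a * x) =
      Real.exp (a ^ 2 / (4 * b)) * Real.exp (-b * (x - a / (2 * b)) ^ 2) := by
  rw [← Real.exp_add]
  congr 1
  field_simp
  ring

theorem integrable_exp_quadratic {b : ℝ} (hb : 0 < b) (a : ℝ) :
    Integrable fun x : ℝ => Real.exp (-b * x ^ 2 + a * x) := by
  simp only [exp_quadratic_eq hb]
  exact ((integrable_exp_neg_mul_sq hb).comp_sub_right (a / (2 * b))).const_mul _

theorem integral_exp_quadratic {b : ℝ} (hb : 0 < b) (a : ℝ) :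
    ∫ x : ℝ, Real.exp (-b * x ^ 2 + a * x) = √(Real.pi / b) * Real.exp (a ^ 2 / (4 * b)) := by
  simp only [exp_quadratic_eq hb]
  rw [integral_const_mul,
    integral_sub_right_eq_self (fun x => Real.exp (-b * x ^ 2)) (a / (2 * b)), integral_gaussian,
    mul_comm]

/-- The Fourier transform of the Gaussian `c exp (-t² / (4 σ²))`. -/
noncomputable def gaussianFT (c σ x : ℝ) : ℝ := c * σ * √2 * Real.exp (-σ ^ 2 * x ^ 2)

variable {c σ : ℝ} (hσ : 0 < σ)

theorem continuous_gaussianFT : Continuous (gaussianFT c σ) := by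
  unfold gaussianFT
  fun_prop

theorem gaussianFT_neg (x : ℝ) : gaussianFT c σ (-x) = gaussianFT c σ x := by
  simp [gaussianFT]

theorem gaussianFT_mul_exp_sq (β x : ℝ) : (gaussianFT c σ x * (Real.exp (β * x) - 1)) ^ 2 =
    2 * c ^ 2 * σ ^ 2 * (Real.exp (-(2 * σ ^ 2) * x ^ 2 + 2 * β * x) -
      2 * Real.exp (-(2 * σ ^ 2) * x ^ 2 + β * x) + Real.exp (-(2 * σ ^ 2) * x ^ 2)) := by
  have h2 : √2 ^ 2 = (2 : ℝ) := Real.sq_sqrt (by norm_num)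
  have e1 : Real.exp (-(2 * σ ^ 2) * x ^ 2 + 2 * β * x) =
      Real.exp (-σ ^ 2 * x ^ 2) ^ 2 * Real.exp (β * x) ^ 2 := by
    rw [← Real.exp_nat_mul, ← Real.exp_nat_mul, ← Real.exp_add]; congr 1; push_cast; ring
  have e2 : Real.exp (-(2 * σ ^ 2) * x ^ 2 + β * x) =
      Real.exp (-σ ^ 2 * x ^ 2) ^ 2 * Real.exp (β * x) := by
    rw [← Real.exp_nat_mul, ← Real.exp_add]; congr 1; push_cast; ring
  have e3 : Real.exp (-(2 * σ ^ 2) * x ^ 2) = Real.exp (-σ ^ 2 * x ^ 2) ^ 2 := by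
    rw [← Real.exp_nat_mul]; congr 1; push_cast; ring
  rw [e1, e2, e3, gaussianFT]
  simp only [mul_pow, h2]
  ring

theorem gaussianFT_sq (x : ℝ) : gaussianFT c σ x ^ 2 =
    2 * c ^ 2 * σ ^ 2 * Real.exp (-(2 * σ ^ 2) * x ^ 2) := by
  have h2 : √2 ^ 2 = (2 : ℝ) := Real.sq_sqrt (by norm_num)
  have e3 : Real.exp (-(2 * σ ^ 2) * x ^ 2) = Real.exp (-σ ^ 2 * x ^ 2) ^ 2 := by
    rw [← Real.exp_nat_mul]; congr 1; push_cast; ring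
  rw [e3, gaussianFT]
  simp only [mul_pow, h2]
  ring

include hσ

theorem integrable_gaussianFT_sq : Integrable fun x => gaussianFT c σ x ^ 2 := by
  simp only [gaussianFT_sq]
  exact (integrable_exp_neg_mul_sq (by positivity)).const_mul _

theorem integrable_gaussianFT_mul_exp_sq (β : ℝ) :
    Integrable fun x => (gaussianFT c σ x * (Real.exp (β * x) - 1)) ^ 2 := by
  have hb : 0 < 2 * σ ^ 2 := by positivity
  simp only [gaussianFT_mul_exp_sq]
  exact (((integrable_exp_quadratic hb _).sub ((integrable_exp_quadratic hb _).const_mul _)).add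
    (integrable_exp_neg_mul_sq hb)).const_mul _

/-- Both the time integral and the left side equal `c² σ √(2π)`; the form chosen is the one met on
the frequency side. -/
theorem gaussian_normalization
    (hc : ∫ t, |c * Real.exp (-(t ^ 2 / (4 * σ ^ 2)))| ^ 2 = 1) :
    2 * c ^ 2 * σ ^ 2 * √(Real.pi / (2 * σ ^ 2)) = 1 := by
  have h : ∀ t : ℝ, |c * Real.exp (-(t ^ 2 / (4 * σ ^ 2)))| ^ 2 =
      c ^ 2 * Real.exp (-(1 / (2 * σ ^ 2)) * t ^ 2) := by
    intro t
    rw [sq_abs, mul_pow, ← Real.exp_nat_mul]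
    congr 2
    push_cast
    field_simp
    ring
  simp only [h, integral_const_mul, integral_gaussian] at hc
  rw [← hc]
  have h3 : Real.pi / (1 / (2 * σ ^ 2)) = (2 * σ ^ 2) ^ 2 * (Real.pi / (2 * σ ^ 2)) := by
    field_simp
  rw [h3, Real.sqrt_mul (by positivity), Real.sqrt_sq (by positivity)]
  ring

theorem integral_gaussianFT_sq
    (hc : ∫ t, |c * Real.exp (-(t ^ 2 / (4 * σ ^ 2)))| ^ 2 = 1) :
    ∫ x, gaussianFT c σ x ^ 2 = 1 := by
  simp only [gaussianFT_sq, integral_const_mul, integral_gaussian]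
  exact gaussian_normalization hσ hc

/-- The integral is exactly `exp(4s) - 2 exp(s) + 1` with `s = β² / (8σ²)`. This vanishes to first
order in `s`, that is, to second order in `β/σ`. -/
theorem integral_gaussianFT_mul_exp_sq_le
    (hc : ∫ t, |c * Real.exp (-(t ^ 2 / (4 * σ ^ 2)))| ^ 2 = 1) {β : ℝ} (hβ : 0 < β)
    (hβσ : β ≤ σ) :
    ∫ x, (gaussianFT c σ x * (Real.exp (β * x) - 1)) ^ 2 ≤ (β / σ) ^ 2 := by
  have hb : 0 < 2 * σ ^ 2 := by positivity
  have h1 := integrable_exp_quadratic hb (2 * β)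
  have h2 := (integrable_exp_quadratic hb β).const_mul 2
  have h12 : Integrable fun x => Real.exp (-(2 * σ ^ 2) * x ^ 2 + 2 * β * x) -
      2 * Real.exp (-(2 * σ ^ 2) * x ^ 2 + β * x) := h1.sub h2
  have hn := gaussian_normalization hσ hc
  simp only [gaussianFT_mul_exp_sq]
  rw [integral_const_mul, integral_add h12 (integrable_exp_neg_mul_sq hb),
    integral_sub h1 h2, integral_const_mul, integral_exp_quadratic hb, integral_exp_quadratic hb,
    integral_gaussian]
  set s := β ^ 2 / (8 * σ ^ 2) with hs
  have e1 : (2 * β) ^ 2 / (4 * (2 * σ ^ 2)) = 4 * s := by rw [hs]; field_simp; ring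
  have e2 : β ^ 2 / (4 * (2 * σ ^ 2)) = s := by rw [hs]; field_simp; ring
  have e3 : (β / σ) ^ 2 = 8 * s := by rw [hs]; field_simp
  have hs0 : 0 ≤ s := by positivity
  -- From `β ≤ σ`; it makes `4s ≤ 1`, the range of the quadratic bound for `exp`, and gives `2s +
  -- 16s² ≤ 8s`.
  have hs1 : s ≤ 1 / 8 := by
    rw [hs, div_le_iff₀ (by positivity)]; nlinarith
  rw [e1, e2, e3]
  have h4 : Real.exp (4 * s) ≤ 1 + 4 * s + (4 * s) ^ 2 := by
    have := Real.abs_exp_sub_one_sub_id_le (x := 4 * s) (by rw [abs_of_nonneg] <;> linarith)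
    linarith [(abs_le.1 this).2]
  have h5 := Real.add_one_le_exp s
  have h6 : 2 * c ^ 2 * σ ^ 2 * (√(Real.pi / (2 * σ ^ 2)) * Real.exp (4 * s) -
      2 * (√(Real.pi / (2 * σ ^ 2)) * Real.exp s) + √(Real.pi / (2 * σ ^ 2))) =
      Real.exp (4 * s) - 2 * Real.exp s + 1 := by
    linear_combination (Real.exp (4 * s) - 2 * Real.exp s + 1) * hn
  rw [h6]
  nlinarith

theorem integrable_gaussian_fourier (ω ν : ℝ) :
    Integrable fun t : ℝ => Complex.exp (-(Complex.I * ω * t)) *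
      ((c * Real.exp (-(t ^ 2 / (4 * σ ^ 2))) : ℝ) : ℂ) * Complex.exp (Complex.I * t * ν) := by
  have hb : ((-(1 / (4 * σ ^ 2)) : ℝ) : ℂ).re < 0 := by
    rw [Complex.ofReal_re]
    exact neg_lt_zero.2 (by positivity)
  refine ((integrable_cexp_quadratic' hb (Complex.I * (ν - ω)) 0).const_mul (c : ℂ)).congr
    (Filter.Eventually.of_forall fun t => ?_)
  dsimp only
  rw [Complex.ofReal_mul, Complex.ofReal_exp, mul_left_comm, mul_assoc, mul_assoc,
    ← Complex.exp_add, ← Complex.exp_add]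
  congr 2
  push_cast
  ring

theorem gaussian_fourier (ω ν : ℝ) :
    ((1 / √(2 * Real.pi) : ℝ) : ℂ) * ∫ t : ℝ, Complex.exp (-(Complex.I * ω * t)) *
      ((c * Real.exp (-(t ^ 2 / (4 * σ ^ 2))) : ℝ) : ℂ) * Complex.exp (Complex.I * t * ν) =
      (gaussianFT c σ (ω - ν) : ℂ) := by
  have hb : ((-(1 / (4 * σ ^ 2)) : ℝ) : ℂ).re < 0 := by
    rw [Complex.ofReal_re]
    exact neg_lt_zero.2 (by positivity)
  have h1 : ∀ t : ℝ, Complex.exp (-(Complex.I * ω * t)) *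
      ((c * Real.exp (-(t ^ 2 / (4 * σ ^ 2))) : ℝ) : ℂ) * Complex.exp (Complex.I * t * ν) =
      c * Complex.exp (((-(1 / (4 * σ ^ 2)) : ℝ) : ℂ) * t ^ 2 + Complex.I * (ν - ω) * t + 0) := by
    intro t
    rw [Complex.ofReal_mul, Complex.ofReal_exp, mul_left_comm, mul_assoc, mul_assoc,
      ← Complex.exp_add, ← Complex.exp_add]
    congr 2
    push_cast
    ring
  simp only [h1]
  rw [integral_const_mul, integral_cexp_quadratic hb]
  have h2 : ((Real.pi : ℂ) / -((-(1 / (4 * σ ^ 2)) : ℝ) : ℂ)) ^ (1 / 2 : ℂ) =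
      ((√(2 * Real.pi) * (σ * √2) : ℝ) : ℂ) := by
    have h3 : √(2 * Real.pi) * (σ * √2) = (Real.pi / (1 / (4 * σ ^ 2))) ^ (1 / 2 : ℝ) := by
      rw [← Real.sqrt_eq_rpow, eq_comm, Real.sqrt_eq_iff_mul_self_eq (by positivity)
        (by positivity)]
      have := Real.mul_self_sqrt (show 0 ≤ 2 * Real.pi by positivity)
      have := Real.mul_self_sqrt (show (0 : ℝ) ≤ 2 by norm_num)
      have h5 : Real.pi / (1 / (4 * σ ^ 2)) = 2 * Real.pi * σ ^ 2 * 2 := by field_simp; ring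
      rw [h5, eq_comm]
      calc _ = (√(2 * Real.pi) * √(2 * Real.pi)) * σ ^ 2 * (√2 * √2) := by ring
        _ = _ := by simp only [*]
    rw [h3, Complex.ofReal_cpow (by positivity)]
    push_cast
    rw [neg_neg]
  have h4 : (0 : ℂ) - (Complex.I * (ν - ω)) ^ 2 / (4 * ((-(1 / (4 * σ ^ 2)) : ℝ) : ℂ)) =
      ((-σ ^ 2 * (ω - ν) ^ 2 : ℝ) : ℂ) := by
    have hσc : (σ : ℂ) ≠ 0 := by exact_mod_cast hσ.ne'
    rw [mul_pow, Complex.I_sq]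
    push_cast
    field_simp
    ring
  rw [h2, h4, ← Complex.ofReal_exp, ← Complex.ofReal_mul, ← Complex.ofReal_mul,
    ← Complex.ofReal_mul, gaussianFT]
  congr 1
  have : √(2 * Real.pi) ≠ 0 := by positivity
  field_simp

end Gaussian

variable {d : ℕ}

/-! ### Gibbs state and approximate detailed balance. -/

section Gibbs

variable {V : Matrix (Fin d) (Fin d) ℂ} (h₁ : Vᴴ * V = 1) (h₂ : V * Vᴴ = 1) (E : Fin d → ℝ)
include h₁ h₂

theorem operatorFT_gaussian_eq_schurMul {c σ : ℝ} (hσ : 0 < σ) (X : Matrix (Fin d) (Fin d) ℂ)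
    (ω : ℝ) :
    operatorFT (V * Matrix.diagonal (fun i => (E i : ℂ)) * Vᴴ)
      (fun t => c * Real.exp (-(t ^ 2 / (4 * σ ^ 2)))) X ω =
      schurMul V E (fun ν => (gaussianFT c σ (ω - ν) : ℂ)) X := by
  simp only [operatorFT, heisenberg_eq_schurMul V E h₁ h₂, ← schurMul_const_mul]
  rw [integral_smul_schurMul V E X fun ν => integrable_gaussian_fourier hσ ω ν,
    ← schurMul_const_mul]
  simp only [gaussian_fourier hσ]

theorem gibbs_eq (β : ℝ) :
    gibbs (V * Matrix.diagonal (fun i => (E i : ℂ)) * Vᴴ) β =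
      V * Matrix.diagonal (fun i => (((∑ k, Real.exp (-β * E k))⁻¹ * Real.exp (-β * E i) : ℝ) : ℂ)) *
        Vᴴ := by
  rw [gibbs, exp_smul_unitary_diagonal V E h₁ h₂, trace_unitary_conj h₁, Matrix.trace_diagonal,
    ← Matrix.smul_mul, ← Matrix.mul_smul, ← Matrix.diagonal_smul]
  congr 3
  ext i
  push_cast
  rfl

theorem isState_gibbs (hd : 1 ≤ d) (β : ℝ) :
    IsState (gibbs (V * Matrix.diagonal (fun i => (E i : ℂ)) * Vᴴ) β) := by
  have : NeZero d := ⟨by omega⟩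
  have hZ : 0 < ∑ k, Real.exp (-β * E k) :=
    Finset.sum_pos (fun _ _ => Real.exp_pos _) Finset.univ_nonempty
  rw [gibbs_eq h₁ h₂]
  refine ⟨posSemidef_unitary_diagonal V fun i => by positivity, ?_⟩
  rw [trace_unitary_conj h₁, Matrix.trace_diagonal, ← Complex.ofReal_sum, ← Finset.mul_sum,
    inv_mul_cancel₀ hZ.ne', Complex.ofReal_one]

/-- Commuting past the Gibbs state gives `exp(-βν)` and KMS gives `exp(βω)`; the product `exp(β(ω -
ν))` is near `1` wherever `g(ω - ν)` is concentrated near zero on the scale `1/β`. The error symbol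
again depends only on `ω - ν`, so the Plancherel bound applies to it. -/
theorem approximate_detailed_balance {γ : ℝ → ℝ} {β : ℝ}
    (hγ : ∀ ω, γ ω = Real.exp (-(β * ω)) * γ (-ω)) (g : ℝ → ℝ)
    (X : Matrix (Fin d) (Fin d) ℂ) (ω : ℝ) :
    (γ (-ω) : ℂ) • (gibbs (V * Matrix.diagonal (fun i => (E i : ℂ)) * Vᴴ) β *
        schurMul V E (fun ν => (g (ω - ν) : ℂ)) X) =
      (γ ω : ℂ) • (schurMul V E (fun ν => (g (ω - ν) : ℂ)) X *
        gibbs (V * Matrix.diagonal (fun i => (E i : ℂ)) * Vᴴ) β) +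
      (γ ω : ℂ) • (schurMul V E
        (fun ν => ((g (ω - ν) * (Real.exp (β * (ω - ν)) - 1) : ℝ) : ℂ)) X *
        gibbs (V * Matrix.diagonal (fun i => (E i : ℂ)) * Vᴴ) β) := by
  rw [gibbs_eq h₁ h₂, diagonal_mul_schurMul_eq V E h₁ _ _
    (fun ν => ((Real.exp (-(β * ν)) : ℝ) : ℂ) * (g (ω - ν) : ℂ)) (fun j k => ?_)]
  · have h3 : γ (-ω) = γ ω * Real.exp (β * ω) := by
      rw [hγ ω, mul_right_comm, ← Real.exp_add, neg_add_cancel, Real.exp_zero, one_mul]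
    have h4 : ∀ ν, ((g (ω - ν) * (Real.exp (β * (ω - ν)) - 1) : ℝ) : ℂ) =
        (Real.exp (β * ω) : ℂ) * (((Real.exp (-(β * ν)) : ℝ) : ℂ) * (g (ω - ν) : ℂ)) -
          (g (ω - ν) : ℂ) := by
      intro ν
      have : Real.exp (β * (ω - ν)) = Real.exp (β * ω) * Real.exp (-(β * ν)) := by
        rw [← Real.exp_add]; congr 1; ring
      rw [this]
      push_cast
      ring
    simp only [h4]
    rw [schurMul_sub, schurMul_const_mul, sub_mul, smul_sub, add_sub_cancel, h3, Matrix.smul_mul,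
      smul_smul, Complex.ofReal_mul]
  · have h5 : Real.exp (-β * E j) = Real.exp (-(β * (E j - E k))) * Real.exp (-β * E k) := by
      rw [← Real.exp_add]; congr 1; ring
    rw [h5]
    push_cast
    ring

end Gibbs

end GibbsSampler

/-! ### Assembly of the estimates. -/

theorem theorem3 :
    ∃ C : ℝ, 0 < C ∧
      ∀ (d m : ℕ) (_ : 1 ≤ d)
        (H : Matrix (Fin d) (Fin d) ℂ) (_ : H.IsHermitian)
        (A : Fin m → Matrix (Fin d) (Fin d) ℂ)
        (_ : ∃ τ : Equiv.Perm (Fin m), ∀ a, A (τ a) = (A a)ᴴ)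
        (_ : ‖∑ a, (A a)ᴴ * A a‖ ≤ 1)
        (β σ : ℝ) (_ : 0 < β) (_ : 0 < σ)
        (f : ℝ → ℝ)
        (_ : ∃ c : ℝ, ∀ t, f t = c * Real.exp (-(t ^ 2 / (4 * σ ^ 2))))
        (_ : ∫ t, |f t| ^ 2 = 1)
        (γ : ℝ → ℝ) (_ : Measurable γ)
        (_ : ∀ ω, γ ω = Real.exp (-(β * ω)) * γ (-ω))
        (_ : ∀ ω, 0 ≤ γ ω ∧ γ ω ≤ 1),
        (∃ ρ, GibbsSampler.IsFixedPoint (GibbsSampler.lindbladian H A f γ) ρ) ∧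
        ∀ ρ, GibbsSampler.IsFixedPoint (GibbsSampler.lindbladian H A f γ) ρ →
          ENNReal.ofReal (GibbsSampler.traceNorm (ρ - GibbsSampler.gibbs H β)) ≤
            ENNReal.ofReal (C * (β / σ) * √(Real.log (2 + σ / β))) *
              GibbsSampler.mixingTime (GibbsSampler.lindbladian H A f γ) := by
  open GibbsSampler in
  -- `8 = 2 · 2 · 2`: the fixed-point bound, the residual bound, and `√log ≥ 1/2`.
  refine ⟨8, by norm_num, ?_⟩
  rintro d m hd H hH A ⟨τ, hτ⟩ hA β σ hβ hσ f ⟨c, hf⟩ hf1 γ hγm hγ hγ01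
  obtain ⟨V, h₁, h₂, h₃⟩ := exists_spectral_decomposition hH
  -- Detaches the eigenvalues from `H`, so that `H` can be substituted away.
  generalize hH.eigenvalues = E at h₃
  obtain rfl : f = fun t => c * Real.exp (-(t ^ 2 / (4 * σ ^ 2))) := funext hf
  subst h₃
  set ρβ := gibbs (V * Matrix.diagonal (fun i => (E i : ℂ)) * Vᴴ) β with hρβ
  have hρ : IsState ρβ := isState_gibbs h₁ h₂ E hd β
  let K : Fin m → ℝ → Matrix (Fin d) (Fin d) ℂ := fun a ω =>
    schurMul V E (fun ν => (gaussianFT c σ (ω - ν) : ℂ)) (A a)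
  have hL : lindbladian (V * Matrix.diagonal (fun i => (E i : ℂ)) * Vᴴ) A
      (fun t => c * Real.exp (-(t ^ 2 / (4 * σ ^ 2)))) γ =
      ∑ a, ∫ ω : ℝ, (γ ω : ℂ) • dissipator (K a ω) := by
    simp only [lindbladian, operatorFT_gaussian_eq_schurMul h₁ h₂ E hσ, K]
  rw [hL]
  set L : Superop d := ∑ a, ∫ ω : ℝ, (γ ω : ℂ) • dissipator (K a ω)
  have hK : ∀ a, Continuous (K a) := fun a => continuous_schurMul_sub continuous_gaussianFT V E (A a)
  have hK2 : ∀ a, MeasureTheory.Integrable fun ω => ‖K a ω‖ ^ 2 := fun a =>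
    integrable_norm_sq_schurMul_sub continuous_gaussianFT (integrable_gaussianFT_sq hσ) V E (A a)
  have hKσ : ∀ s : Matrix (Fin d) (Fin d) ℂ, s.PosSemidef →
      ∑ a, ∫ ω : ℝ, (K a ω * s * (K a ω)ᴴ).trace.re ≤ s.trace.re := by
    intro s hs
    have h := sum_integral_trace_schurMul_sandwich_le continuous_gaussianFT
      (integrable_gaussianFT_sq (c := c) hσ) h₁ h₂ E A hs
    rw [integral_gaussianFT_sq hσ hf1, one_mul] at h
    exact h.trans (mul_le_of_le_one_left (Complex.nonneg_iff.1 hs.trace_nonneg).1 hA)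
  have hgen : IsMarkovGenerator L :=
    isMarkovGenerator_sum_integral_dissipator hγm hγ01 hK hK2
  have hres : traceNorm (L ρβ) ≤ 2 * (β / σ) := by
    rcases le_total β σ with h | h
    · have hκ : 0 < β / σ := by positivity
      have hg : Continuous fun x => gaussianFT c σ x * (Real.exp (β * x) - 1) :=
        continuous_gaussianFT.mul (by fun_prop)
      have hg2 := integrable_gaussianFT_mul_exp_sq (c := c) hσ β
      have hB := sum_integral_trace_schurMul_sandwich_le hg hg2 h₁ h₂ E A hρ.1
      rw [hρ.2, Complex.one_re, mul_one] at hB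
      have hle := traceNorm_sum_integral_dissipator_le hγm hγ01 hK hK2
        (fun a => continuous_schurMul_sub hg V E (A a))
        (fun a => integrable_norm_sq_schurMul_sub hg hg2 V E (A a)) hKσ hρ hκ
        (hB.trans ((mul_le_of_le_one_left (MeasureTheory.integral_nonneg fun _ => sq_nonneg _)
          hA).trans (integral_gaussianFT_mul_exp_sq_le hσ hf1 hβ h)))
        τ (fun a ω => ?_) (fun a ω => approximate_detailed_balance h₁ h₂ E hγ _ (A a) ω)
      · linarith
      · simp only [K]
        rw [conjTranspose_schurMul V E (fun ν => gaussianFT c σ (ω - ν)), hτ]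
        congr 1
        ext ν
        rw [← gaussianFT_neg]
        congr 2
        ring
    · have hle := traceNorm_sum_integral_dissipator_le_two hγm hγ01 hK hK2 hKσ hρ
      have : 1 ≤ β / σ := (one_le_div hσ).2 h
      linarith
  refine ⟨hgen.exists_isFixedPoint hρ, fun ρ hfix => ?_⟩
  have hlog : 1 / 2 ≤ √(Real.log (2 + σ / β)) := by
    apply Real.le_sqrt_of_sq_le
    have h2 : Real.log 2 ≤ Real.log (2 + σ / β) :=
      Real.log_le_log (by norm_num) (by have : 0 < σ / β := by positivity
                                        linarith)
    have := Real.log_two_gt_d9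
    norm_num
    linarith
  have hcoef : 0 < 8 * (β / σ) * √(Real.log (2 + σ / β)) := by positivity
  -- A positive finite factor passes through the infimum, so each halving time is treated
  -- separately; neither attainment nor finiteness is needed.
  rw [mixingTime, ENNReal.mul_iInf_of_ne (by simpa using hcoef) ENNReal.ofReal_ne_top]
  refine le_iInf fun t => ?_
  rw [ENNReal.mul_iInf_of_ne (by simpa using hcoef) ENNReal.ofReal_ne_top]
  refine le_iInf fun ht => ?_
  rw [← ENNReal.ofReal_coe_nnreal, ← ENNReal.ofReal_mul hcoef.le]
  refine ENNReal.ofReal_le_ofReal ((hgen.traceNorm_fixedPoint_sub_le ht hfix hρ).trans ?_)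
  have ht0 : (0 : ℝ) ≤ t := t.2
  have hκ : 0 < β / σ := by positivity
  calc 2 * (t : ℝ) * traceNorm (L ρβ) ≤ 2 * t * (2 * (β / σ)) := by gcongr
    _ = 8 * (β / σ) * (1 / 2) * t := by ring
    _ ≤ _ := by gcongr
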